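/- Let $D$ be the open unit disc. Let $H^2=H^2(\mathbb C,D)$ be the Hilbert space of analytic functions $f$ on $D$ with $$\|f\|^2=\sup_{0\le r<1}\frac1{2\pi}\int_0^{2\pi}|f(re^{i\theta})|^2\,d\theta<\infty ,$$ let $H^\infty(D)$ be the algebra of bounded analytic functions on $D$, and let $R$ be either $\mathbb C[z]$ or $H^\infty(D)$, acting on $H^2$ by pointwise multiplication. For $f$ in $R$ or $H^2$, let $\operatorname{ord}(f)\in\{0,1,2,\dots\}\cup\{\infty\}$ be the order of the zero of $f$ at $0$, and put $R_1=\{r\in R:\operatorname{ord}(r)\ge 1\}$. For a closed subspace $V\subseteq H^2$ and $k\ge 0$ let $$V_k=\{h\in V:\operatorname{ord}(h)\ge k\},\qquad W_k=V_k\ominus V_{k+1};$$ the $W_k$ are the components of the near homogeneous decomposition $V=W_0\oplus W_1\oplus W_2\oplus\cdots$. Let $P_m$ be the orthogonal projection of $H^2$ onto the $m$-th component of the near homogeneous decomposition of $H^2$ itself. The near homogeneous decomposition of $V$ is *near inner* if for all $k,m\ge 0$, $h\in W_k$, $g\in V$, $r\in R_1$ with $\operatorname{ord}(rh+g)>m$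 one has $rh+g\perp W_m$. It has the *full projection property* if for all $k,m\ge0$, $r\in R_1$, $h\in W_k$, $g\in V$ with $\operatorname{ord}(rh+g)\ge m$ one has $P_m(rh+g)\in P_m(W_m)$. An *inner function* is an $I\in H^\infty(D)$ whose radial boundary values $\lim_{r\to1^-}I(re^{i\theta})$ exist and have modulus $1$ for almost every $\theta$. **Theorem 8.1.** (i) Let $V\ne\{0\}$ be a closed subspace of $H^2$ whose near homogeneous decomposition is near inner and has the full projection property. Then $V$ is $R$-invariant, and there is an inner function $I$ such that $V=I\cdot H^2$. (ii) Conversely, if $I$ is an inner function, then $I\cdot H^2$ is a nonzero closed $R$-invariant subspace of $H^2$. (iii) Consequently (the classical Beurling theorem), a closed subspace $V\neq\{0\}$ of $H^2$ is $R$-invariant if and only if $V=I\cdot H^2$ for some inner function $I$. -/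

import Mathlib

open Filter Topology Complex
open scoped UnitDisc ComplexConjugate

noncomputable section

/-! ### Analytic functions on the unit disc -/

/-- Extension by zero of a function on the open unit disc `𝔻` to all of `ℂ`.
It only serves to apply notions stated for functions on `ℂ` at points of the disc. -/
def discExt (f : 𝔻 → ℂ) : ℂ → ℂ := fun z => if hz : ‖z‖ < 1 then f (UnitDisc.mk z hz) else 0

/-- `f` is analytic on the open unit disc. -/
def AnalyticOnDisc (f : 𝔻 → ℂ) : Prop := DifferentiableOn ℂ (discExt f) (Metric.ball 0 1)

/-- The order of the zero of `f` at the basepoint `0` (it is `⊤` iff `f` vanishes near `0`). -/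
def discOrd (f : 𝔻 → ℂ) : ℕ∞ := analyticOrderAt (discExt f) 0

/-- The `n`-th Taylor coefficient of `f` at `0`. -/
def taylorCoeff (f : 𝔻 → ℂ) (n : ℕ) : ℂ := (n.factorial : ℂ)⁻¹ * iteratedDeriv n (discExt f) 0

/-- The mean `(1 / 2π) ∫ |f(r e^{iθ})|² dθ` over the circle of radius `r`. -/
def circleMean (f : 𝔻 → ℂ) (r : ℝ) : ℝ := Real.circleAverage (fun z => ‖discExt f z‖ ^ 2) 0 r

theorem discExt_add (f g : 𝔻 → ℂ) : discExt (f + g) = discExt f + discExt g := by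
  ext z; by_cases h : ‖z‖ < 1 <;> simp [discExt, h]

theorem discExt_smul (c : ℂ) (f : 𝔻 → ℂ) : discExt (c • f) = c • discExt f := by
  ext z; by_cases h : ‖z‖ < 1 <;> simp [discExt, h]

theorem discExt_mul (f g : 𝔻 → ℂ) : discExt (f * g) = discExt f * discExt g := by
  ext z; by_cases h : ‖z‖ < 1 <;> simp [discExt, h]

theorem discExt_coe (f : 𝔻 → ℂ) (z : 𝔻) : discExt f z = f z := by
  simp [discExt, z.norm_lt_one]

theorem discExt_of (F : ℂ → ℂ) {z : ℂ} (hz : z ∈ Metric.ball (0 : ℂ) 1) :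
    discExt (fun w : 𝔻 => F w) z = F z := by
  rw [mem_ball_zero_iff] at hz
  simp [discExt, hz]

theorem AnalyticOnDisc.of {F : ℂ → ℂ} (hF : DifferentiableOn ℂ F (Metric.ball 0 1)) :
    AnalyticOnDisc (fun w : 𝔻 => F w) :=
  hF.congr fun _ hz => discExt_of F hz

theorem AnalyticOnDisc.add {f g : 𝔻 → ℂ} (hf : AnalyticOnDisc f) (hg : AnalyticOnDisc g) :
    AnalyticOnDisc (f + g) := by
  unfold AnalyticOnDisc; rw [discExt_add]; exact DifferentiableOn.add hf hg

theorem AnalyticOnDisc.smul {f : 𝔻 → ℂ} (c : ℂ) (hf : AnalyticOnDisc f) :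
    AnalyticOnDisc (c • f) := by
  unfold AnalyticOnDisc; rw [discExt_smul]; exact DifferentiableOn.const_smul hf c

theorem AnalyticOnDisc.mul {f g : 𝔻 → ℂ} (hf : AnalyticOnDisc f) (hg : AnalyticOnDisc g) :
    AnalyticOnDisc (f * g) := by
  unfold AnalyticOnDisc; rw [discExt_mul]; exact DifferentiableOn.mul hf hg

theorem AnalyticOnDisc.const (c : ℂ) : AnalyticOnDisc (fun _ => c) :=
  AnalyticOnDisc.of (F := fun _ => c) (differentiableOn_const c)

theorem AnalyticOnDisc.analyticAt {f : 𝔻 → ℂ} (hf : AnalyticOnDisc f) :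
    AnalyticAt ℂ (discExt f) 0 :=
  DifferentiableOn.analyticAt hf (Metric.ball_mem_nhds 0 one_pos)

theorem AnalyticOnDisc.hasSum {f : 𝔻 → ℂ} (hf : AnalyticOnDisc f) {z : ℂ}
    (hz : z ∈ Metric.ball (0 : ℂ) 1) :
    HasSum (fun n => taylorCoeff f n * z ^ n) (discExt f z) := by
  convert! Complex.hasSum_taylorSeries_on_ball hf hz using 2 with n
  simp [taylorCoeff]; ring

theorem AnalyticOnDisc.taylorCoeff_add {f g : 𝔻 → ℂ} (hf : AnalyticOnDisc f)
    (hg : AnalyticOnDisc g) (n : ℕ) :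
    taylorCoeff (f + g) n = taylorCoeff f n + taylorCoeff g n := by
  simp only [taylorCoeff, discExt_add]
  rw [iteratedDeriv_add hf.analyticAt.contDiffAt hg.analyticAt.contDiffAt, mul_add]

theorem taylorCoeff_smul (c : ℂ) (f : 𝔻 → ℂ) (n : ℕ) :
    taylorCoeff (c • f) n = c * taylorCoeff f n := by
  simp only [taylorCoeff, discExt_smul]
  rw [iteratedDeriv_const_smul_field]
  simp; ring

theorem AnalyticOnDisc.le_discOrd_iff {f : 𝔻 → ℂ} (hf : AnalyticOnDisc f) (n : ℕ) :
    (n : ℕ∞) ≤ discOrd f ↔ ∀ i < n, taylorCoeff f i = 0 := by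
  rw [discOrd, natCast_le_analyticOrderAt_iff_iteratedDeriv_eq_zero hf.analyticAt]
  simp [taylorCoeff, Nat.factorial_ne_zero]

theorem circle_mem_ball {r : ℝ} (h0 : 0 ≤ r) (h1 : r < 1) {z : ℂ}
    (hz : z ∈ Metric.sphere (0 : ℂ) |r|) : z ∈ Metric.ball (0 : ℂ) 1 := by
  rw [mem_sphere_zero_iff_norm, abs_of_nonneg h0] at hz
  rw [mem_ball_zero_iff, hz]; exact h1

/-- Parseval's identity on the circle of radius `r < 1`. -/
theorem AnalyticOnDisc.hasSum_circleMean {f : 𝔻 → ℂ} (hf : AnalyticOnDisc f) {r : ℝ}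
    (h0 : 0 ≤ r) (h1 : r < 1) :
    HasSum (fun n => ‖taylorCoeff f n‖ ^ 2 * r ^ (2 * n)) (circleMean f r) := by
  have hsum : Summable fun n => ‖taylorCoeff f n‖ * r ^ n := by
    have hr : (r : ℂ) ∈ Metric.ball (0 : ℂ) 1 := by
      simpa [abs_of_nonneg h0] using h1
    simpa [abs_of_nonneg h0] using (hf.hasSum hr).summable.norm
  rw [hasSum_iff_tendsto_nat_of_nonneg
    (fun n => mul_nonneg (by positivity) (pow_nonneg h0 _))]
  let p : ℕ → Polynomial ℂ := fun N =>
    ∑ n ∈ Finset.range N, Polynomial.monomial n (taylorCoeff f n * (r : ℂ) ^ n)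
  have hcoeff : ∀ N i, (p N).coeff i = if i < N then taylorCoeff f i * (r : ℂ) ^ i else 0 := by
    intro N i
    simp [p, Polynomial.coeff_monomial]
  have hP : ∀ N, ∑ i ∈ Finset.range N, ‖taylorCoeff f i‖ ^ 2 * r ^ (2 * i) =
      Real.circleAverage (fun z => ‖(p N).eval z‖ ^ 2) 0 1 := by
    intro N
    rw [← Polynomial.sum_sq_norm_coeff_eq_circleAverage]
    have hsub : (p N).support ⊆ Finset.range N := by
      intro i hi
      by_contra h
      rw [Polynomial.mem_support_iff, hcoeff] at hi
      simp only [Finset.mem_range] at h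
      simp [h] at hi
    rw [Finset.sum_subset hsub]
    · refine Finset.sum_congr rfl fun i hi => ?_
      rw [hcoeff, if_pos (Finset.mem_range.1 hi), norm_mul, norm_pow, Complex.norm_real,
        Real.norm_eq_abs, abs_of_nonneg h0]
      ring
    · intro i _ hi
      simp [Polynomial.notMem_support_iff.1 hi]
  have heval : ∀ N z, (p N).eval z = ∑ n ∈ Finset.range N, taylorCoeff f n * (r * z) ^ n := by
    intro N z
    simp only [p, Polynomial.eval_finsetSum, Polynomial.eval_monomial]
    exact Finset.sum_congr rfl fun n _ => by ring
  simp_rw [hP]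
  rw [circleMean, Real.circleAverage_eq_circleAverage_zero_one]
  simp only [Real.circleAverage_def, add_zero]
  refine Tendsto.const_smul ?_ _
  refine intervalIntegral.tendsto_integral_filter_of_dominated_convergence
    (fun _ => (∑' n, ‖taylorCoeff f n‖ * r ^ n) ^ 2) ?_ ?_ intervalIntegrable_const ?_
  · refine Eventually.of_forall fun N => Continuous.aestronglyMeasurable ?_
    have : Continuous fun z : ℂ => (p N).eval z := (p N).continuous
    fun_prop
  · refine Eventually.of_forall fun N => Eventually.of_forall fun θ _ => ?_
    rw [Real.norm_eq_abs, abs_of_nonneg (by positivity), heval]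
    gcongr
    refine (norm_sum_le _ _).trans ?_
    refine le_trans (le_of_eq ?_) (hsum.sum_le_tsum (Finset.range N)
      (fun n _ => mul_nonneg (norm_nonneg _) (pow_nonneg h0 n)))
    refine Finset.sum_congr rfl fun n _ => ?_
    simp [abs_of_nonneg h0]
  · refine Eventually.of_forall fun θ _ => ?_
    have hz : (r : ℂ) * circleMap 0 1 θ ∈ Metric.ball (0 : ℂ) 1 := by
      simpa [abs_of_nonneg h0] using h1
    have := (hf.hasSum hz).tendsto_sum_nat
    simp only [heval]
    exact (this.norm).pow 2

theorem AnalyticOnDisc.circleMean_le {f : 𝔻 → ℂ} (hf : AnalyticOnDisc f)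
    (hs : Summable fun n => ‖taylorCoeff f n‖ ^ 2) {r : ℝ} (h0 : 0 ≤ r) (h1 : r < 1) :
    circleMean f r ≤ ∑' n, ‖taylorCoeff f n‖ ^ 2 := by
  refine hasSum_le (fun n => ?_) (hf.hasSum_circleMean h0 h1) hs.hasSum
  exact mul_le_of_le_one_right (by positivity) (pow_le_one₀ h0 h1.le)

theorem AnalyticOnDisc.sum_le {f : 𝔻 → ℂ} (hf : AnalyticOnDisc f) {C : ℝ}
    (hC : ∀ r : ℝ, 0 ≤ r → r < 1 → circleMean f r ≤ C) (s : Finset ℕ) :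
    ∑ n ∈ s, ‖taylorCoeff f n‖ ^ 2 ≤ C := by
  have hlim : Tendsto (fun r : ℝ => ∑ n ∈ s, ‖taylorCoeff f n‖ ^ 2 * r ^ (2 * n)) (𝓝[<] 1)
      (𝓝 (∑ n ∈ s, ‖taylorCoeff f n‖ ^ 2)) := by
    have : Continuous (fun r : ℝ => ∑ n ∈ s, ‖taylorCoeff f n‖ ^ 2 * r ^ (2 * n)) := by fun_prop
    have h := this.tendsto 1
    simp only [one_pow, mul_one] at h
    exact h.mono_left nhdsWithin_le_nhds
  refine le_of_tendsto hlim ?_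
  filter_upwards [Ioo_mem_nhdsLT (zero_lt_one : (0 : ℝ) < 1)] with r hr
  refine le_trans ?_ (hC r hr.1.le hr.2)
  exact sum_le_hasSum s (fun n _ => mul_nonneg (by positivity) (pow_nonneg hr.1.le _))
    (hf.hasSum_circleMean hr.1.le hr.2)

theorem AnalyticOnDisc.summable_iff {f : 𝔻 → ℂ} (hf : AnalyticOnDisc f) :
    (Summable fun n => ‖taylorCoeff f n‖ ^ 2) ↔
      ∃ C : ℝ, ∀ r : ℝ, 0 ≤ r → r < 1 → circleMean f r ≤ C := by
  refine ⟨fun hs => ⟨_, fun r h0 h1 => hf.circleMean_le hs h0 h1⟩, fun ⟨C, hC⟩ => ?_⟩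
  exact summable_of_sum_le (fun n => by positivity) (hf.sum_le hC)

/-! ### The Hardy space `H²(ℂ, D)` and the algebra `H^∞(D)` -/

theorem summable_sq_add {a b : ℕ → ℂ} (ha : Summable fun n => ‖a n‖ ^ 2)
    (hb : Summable fun n => ‖b n‖ ^ 2) : Summable fun n => ‖a n + b n‖ ^ 2 := by
  refine Summable.of_nonneg_of_le (fun n => by positivity) (fun n => ?_)
    ((ha.add hb).mul_left 2)
  have := norm_add_le (a n) (b n)
  nlinarith [sq_nonneg (‖a n‖ - ‖b n‖), norm_nonneg (a n + b n), norm_nonneg (a n),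
    norm_nonneg (b n)]

/-- The linear space of analytic functions on the disc whose square means over the circles
of radius `r < 1` are bounded. -/
def hardySubmodule : Submodule ℂ (𝔻 → ℂ) where
  carrier := {f | AnalyticOnDisc f ∧ ∃ C : ℝ, ∀ r : ℝ, 0 ≤ r → r < 1 → circleMean f r ≤ C}
  zero_mem' := ⟨AnalyticOnDisc.const 0, 0, fun r _ _ => by
    have : discExt 0 = 0 := by ext z; simp [discExt]
    simp [circleMean, this, Real.circleAverage_const]⟩
  add_mem' := by
    rintro f g ⟨hf, hf'⟩ ⟨hg, hg'⟩
    refine ⟨hf.add hg, ?_⟩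
    rw [← hf.summable_iff] at hf'
    rw [← hg.summable_iff] at hg'
    rw [← (hf.add hg).summable_iff]
    simp only [hf.taylorCoeff_add hg]
    exact summable_sq_add hf' hg'
  smul_mem' := by
    rintro c f ⟨hf, hf'⟩
    refine ⟨hf.smul c, ?_⟩
    rw [← hf.summable_iff] at hf'
    rw [← (hf.smul c).summable_iff]
    simp only [taylorCoeff_smul, norm_mul, mul_pow]
    exact hf'.mul_left _

/-- The Hardy space `H²(ℂ, D)`; its elements are functions on the disc. -/
def HardyTwo : Type := hardySubmodule

namespace HardyTwo

instance : AddCommGroup HardyTwo := inferInstanceAs (AddCommGroup hardySubmodule)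
instance : Module ℂ HardyTwo := inferInstanceAs (Module ℂ hardySubmodule)

/-- The underlying function on the disc. -/
def toFun (f : HardyTwo) : 𝔻 → ℂ := Subtype.val f

theorem analytic (f : HardyTwo) : AnalyticOnDisc f.toFun := (Subtype.prop f).1

theorem bounded (f : HardyTwo) :
    ∃ C : ℝ, ∀ r : ℝ, 0 ≤ r → r < 1 → circleMean f.toFun r ≤ C := (Subtype.prop f).2

theorem toFun_add (f g : HardyTwo) : (f + g).toFun = f.toFun + g.toFun := rfl
theorem toFun_smul (c : ℂ) (f : HardyTwo) : (c • f).toFun = c • f.toFun := rfl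
theorem toFun_injective : Function.Injective toFun := Subtype.val_injective

theorem summable (f : HardyTwo) : Summable fun n => ‖taylorCoeff f.toFun n‖ ^ 2 :=
  f.analytic.summable_iff.2 f.bounded

/-- The sequence of Taylor coefficients, as an element of `ℓ²`. -/
def toSeq : HardyTwo →ₗ[ℂ] lp (fun _ : ℕ => ℂ) 2 where
  toFun f := ⟨taylorCoeff f.toFun, memℓp_gen (by simpa using f.summable)⟩
  map_add' f g := by
    ext n; exact f.analytic.taylorCoeff_add g.analytic n
  map_smul' c f := by
    ext n; exact taylorCoeff_smul c f.toFun n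

theorem toSeq_apply (f : HardyTwo) (n : ℕ) : toSeq f n = taylorCoeff f.toFun n := rfl

theorem toSeq_injective : Function.Injective toSeq := by
  intro f g h
  apply toFun_injective
  ext z
  rw [← discExt_coe f.toFun, ← discExt_coe g.toFun]
  have hz : (z : ℂ) ∈ Metric.ball (0 : ℂ) 1 := mem_ball_zero_iff.2 z.norm_lt_one
  refine (f.analytic.hasSum hz).unique ?_
  have := g.analytic.hasSum hz
  simpa only [← toSeq_apply, h] using this

/-- The Hardy space norm and inner product, `⟪f, g⟫ = ∑ conj (aₙ) bₙ` in terms of Taylor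
coefficients. By `HardyTwo.norm_sq_eq` below this is the norm given by
`‖f‖² = sup_{0 ≤ r < 1} (1 / 2π) ∫ |f(r e^{iθ})|² dθ`. -/
instance : NormedAddCommGroup HardyTwo :=
  NormedAddCommGroup.induced HardyTwo (lp (fun _ : ℕ => ℂ) 2) toSeq toSeq_injective

instance : InnerProductSpace ℂ HardyTwo := InnerProductSpace.induced toSeq

theorem norm_eq (f : HardyTwo) : ‖f‖ = ‖toSeq f‖ := rfl

theorem norm_sq_eq_tsum (f : HardyTwo) : ‖f‖ ^ 2 = ∑' n, ‖taylorCoeff f.toFun n‖ ^ 2 := by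
  have := lp.norm_rpow_eq_tsum (p := 2) (by simp) (toSeq f)
  simpa [norm_eq, toSeq_apply] using this

/-- The norm is the classical Hardy space norm. -/
theorem norm_sq_eq (f : HardyTwo) :
    IsLUB ((circleMean f.toFun) '' Set.Ico 0 1) (‖f‖ ^ 2) := by
  rw [norm_sq_eq_tsum]
  refine ⟨?_, fun C hC => ?_⟩
  · rintro _ ⟨r, hr, rfl⟩
    exact f.analytic.circleMean_le f.summable hr.1 hr.2
  · exact f.summable.tsum_le_of_sum_le
      (f.analytic.sum_le fun r h0 h1 => hC ⟨r, ⟨h0, h1⟩, rfl⟩)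

theorem toSeq_surjective : Function.Surjective toSeq := by
  intro a
  let P := FormalMultilinearSeries.ofScalars ℂ (fun n => a n)
  have hrad : (1 : ENNReal) ≤ P.radius := by
    refine P.le_radius_of_bound (r := 1) ‖a‖ fun n => ?_
    simpa [P] using lp.norm_apply_le_norm two_ne_zero a n
  have hB : HasFPowerSeriesOnBall P.sum P 0 1 :=
    (P.hasFPowerSeriesOnBall (one_pos.trans_le hrad)).mono one_pos hrad
  have hd : DifferentiableOn ℂ P.sum (Metric.ball 0 1) := by
    have := hB.differentiableOn
    rwa [← ENNReal.coe_one, Metric.eball_coe] at this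
  let f : 𝔻 → ℂ := fun w => P.sum w
  have hf : AnalyticOnDisc f := AnalyticOnDisc.of hd
  have hc : ∀ n, taylorCoeff f n = a n := by
    intro n
    have he : discExt f =ᶠ[𝓝 0] P.sum := by
      filter_upwards [Metric.ball_mem_nhds (0 : ℂ) one_pos] with z hz
      exact discExt_of _ hz
    have h1 := hB.hasFPowerSeriesAt.eq_formalMultilinearSeries hB.analyticAt.hasFPowerSeriesAt
    have h2 := congrFun (FormalMultilinearSeries.ofScalars_series_injective ℂ ℂ h1) n
    rw [taylorCoeff, he.iteratedDeriv_eq, h2, div_eq_inv_mul]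
  have hs : Summable fun n => ‖taylorCoeff f n‖ ^ 2 := by
    simp only [hc]
    simpa using (lp.memℓp a).summable (by simp)
  refine ⟨⟨f, hf, hf.summable_iff.1 hs⟩, ?_⟩
  ext n
  exact hc n

/-- `H²` is complete, that is, a Hilbert space. -/
instance : CompleteSpace HardyTwo := by
  have e : HardyTwo ≃ᵢ lp (fun _ : ℕ => ℂ) 2 :=
    ⟨Equiv.ofBijective toSeq ⟨toSeq_injective, toSeq_surjective⟩,
      AddMonoidHomClass.isometry_of_norm toSeq fun f => rfl⟩
  exact e.completeSpace

/-- The order of the zero at `0`. -/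
def ord (f : HardyTwo) : ℕ∞ := discOrd f.toFun

end HardyTwo

/-- The algebra `H^∞(D)` of bounded analytic functions on the disc. -/
def HInfty : Subalgebra ℂ (𝔻 → ℂ) where
  carrier := {r | AnalyticOnDisc r ∧ ∃ C : ℝ, ∀ z, ‖r z‖ ≤ C}
  mul_mem' := by
    rintro f g ⟨hf, C, hC⟩ ⟨hg, C', hC'⟩
    refine ⟨hf.mul hg, C * C', fun z => ?_⟩
    rw [Pi.mul_apply, norm_mul]
    exact mul_le_mul (hC z) (hC' z) (norm_nonneg _) ((norm_nonneg _).trans (hC z))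
  add_mem' := by
    rintro f g ⟨hf, C, hC⟩ ⟨hg, C', hC'⟩
    exact ⟨hf.add hg, C + C', fun z => (norm_add_le _ _).trans (add_le_add (hC z) (hC' z))⟩
  algebraMap_mem' c := ⟨AnalyticOnDisc.const c, ‖c‖, fun _ => le_rfl⟩

/-- The coordinate function `z`, as an element of `H^∞(D)`. -/
def coordZ : HInfty :=
  ⟨fun w => (w : ℂ), AnalyticOnDisc.of (F := id) differentiableOn_id, 1, fun z => z.norm_lt_one.le⟩

/-- The algebra `ℂ[z]` of polynomial functions on the disc. -/
def polyAlgebra : Subalgebra ℂ HInfty := Algebra.adjoin ℂ {coordZ}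

/-- The order of the zero at `0` of an element of `H^∞(D)`. -/
def hInftyOrd (r : HInfty) : ℕ∞ := discOrd r.1

theorem hInfty_mul_mem (r : HInfty) (f : HardyTwo) : r.1 * f.toFun ∈ hardySubmodule := by
  obtain ⟨hr, C, hC⟩ := r.2
  obtain ⟨M, hM⟩ := f.bounded
  refine ⟨hr.mul f.analytic, C ^ 2 * M, fun s h0 h1 => ?_⟩
  refine le_trans ?_ (mul_le_mul_of_nonneg_left (hM s h0 h1) (sq_nonneg C))
  have hc : ∀ {g : 𝔻 → ℂ}, AnalyticOnDisc g →
      CircleIntegrable (fun z => ‖discExt g z‖ ^ 2) 0 s := fun {g} hg =>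
    ContinuousOn.circleIntegrable' <|
      ((DifferentiableOn.continuousOn hg).mono fun _ hz => circle_mem_ball h0 h1 hz).norm.pow 2
  change Real.circleAverage (fun z => ‖discExt (r.1 * f.toFun) z‖ ^ 2) 0 s ≤
    C ^ 2 • Real.circleAverage (fun z => ‖discExt f.toFun z‖ ^ 2) 0 s
  rw [← Real.circleAverage_fun_smul]
  refine Real.circleAverage_mono (hc (hr.mul f.analytic)) ((hc f.analytic).const_mul _) ?_
  intro z hz
  have hz' := mem_ball_zero_iff.1 (circle_mem_ball h0 h1 hz)
  rw [discExt_mul, Pi.mul_apply, norm_mul, mul_pow, smul_eq_mul]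
  have : ‖discExt r.1 z‖ ≤ C := by
    simpa [discExt, hz'] using hC (UnitDisc.mk z hz')
  gcongr

/-- `H²(ℂ, D)` is a module over `H^∞(D)` (hence over each of its subalgebras) by pointwise
multiplication. -/
instance : Module HInfty HardyTwo where
  smul r f := ⟨r.1 * f.toFun, hInfty_mul_mem r f⟩
  one_smul f := Subtype.ext (one_mul f.toFun)
  mul_smul r s f := Subtype.ext (mul_assoc r.1 s.1 f.toFun)
  smul_zero r := Subtype.ext (mul_zero r.1)
  smul_add r f g := Subtype.ext (mul_add r.1 f.toFun g.toFun)
  add_smul r s f := Subtype.ext (add_mul r.1 s.1 f.toFun)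
  zero_smul f := Subtype.ext (zero_mul f.toFun)

theorem HardyTwo.toFun_hsmul (r : HInfty) (f : HardyTwo) : (r • f).toFun = r.1 * f.toFun := rfl

/-! ### The near homogeneous decomposition -/

/-- The terms `V_k = {h ∈ V : ord h ≥ k}` of the valuation subspace series of `V`. -/
def valSub (V : Submodule ℂ HardyTwo) (k : ℕ) : Submodule ℂ HardyTwo where
  carrier := {h | h ∈ V ∧ (k : ℕ∞) ≤ h.ord}
  zero_mem' := ⟨V.zero_mem, by
    rw [HardyTwo.ord, (0 : HardyTwo).analytic.le_discOrd_iff]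
    intro i _
    rw [← HardyTwo.toSeq_apply, map_zero]; rfl⟩
  add_mem' := by
    rintro f g ⟨hf, hf'⟩ ⟨hg, hg'⟩
    refine ⟨V.add_mem hf hg, ?_⟩
    rw [HardyTwo.ord, (HardyTwo.analytic _).le_discOrd_iff] at *
    intro i hi
    rw [HardyTwo.toFun_add, f.analytic.taylorCoeff_add g.analytic, hf' i hi, hg' i hi, add_zero]
  smul_mem' := by
    rintro c f ⟨hf, hf'⟩
    refine ⟨V.smul_mem c hf, ?_⟩
    rw [HardyTwo.ord, (HardyTwo.analytic _).le_discOrd_iff] at *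
    intro i hi
    rw [HardyTwo.toFun_smul, taylorCoeff_smul, hf' i hi, mul_zero]

/-- The near homogeneous component `W_k = V_k ⊖ V_{k+1}` of `V`. -/
def nearHomComp (V : Submodule ℂ HardyTwo) (k : ℕ) : Submodule ℂ HardyTwo :=
  valSub V k ⊓ (valSub V (k + 1))ᗮ

theorem isClosed_valSub_top (k : ℕ) : IsClosed (valSub ⊤ k : Set HardyTwo) := by
  have hcont : ∀ i : ℕ, Continuous fun h : HardyTwo => HardyTwo.toSeq h i := by
    intro i
    have h1 : Isometry HardyTwo.toSeq :=
      AddMonoidHomClass.isometry_of_norm HardyTwo.toSeq fun f => rfl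
    exact (lp.evalCLM ℂ (fun _ : ℕ => ℂ) 2 i).continuous.comp h1.continuous
  have : (valSub ⊤ k : Set HardyTwo) = ⋂ i, ⋂ _ : i < k, {h | HardyTwo.toSeq h i = 0} := by
    ext h
    simp only [Set.mem_iInter, Set.mem_ofPred_eq]
    change (h ∈ (⊤ : Submodule ℂ HardyTwo) ∧ (k : ℕ∞) ≤ h.ord) ↔ _
    rw [HardyTwo.ord, h.analytic.le_discOrd_iff]
    simp [HardyTwo.toSeq_apply]
  rw [this]
  exact isClosed_iInter fun i => isClosed_iInter fun _ => isClosed_eq (hcont i) continuous_const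

instance (m : ℕ) : CompleteSpace (nearHomComp ⊤ m) :=
  ((isClosed_valSub_top m).inter (Submodule.isClosed_orthogonal _)).completeSpace_coe

/-- The orthogonal projection `P_m` of `H²` onto its own near homogeneous component `H_m`. -/
def homProj (m : ℕ) : HardyTwo →L[ℂ] HardyTwo := (nearHomComp ⊤ m).starProjection

/-- The near homogeneous decomposition of `V` is near inner, with respect to the algebra `R`;
`R_1` consists of the `r ∈ R` with `ord r ≥ 1`. -/
def IsNearInner (R : Subalgebra ℂ HInfty) (V : Submodule ℂ HardyTwo) : Prop :=
  ∀ k m : ℕ, ∀ h ∈ nearHomComp V k, ∀ g ∈ V, ∀ r ∈ R, 1 ≤ hInftyOrd r →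
    (m : ℕ∞) < (r • h + g).ord → r • h + g ∈ (nearHomComp V m)ᗮ

/-- The near homogeneous decomposition of `V` has the full projection property, with respect to
the algebra `R`. -/
def HasFullProjection (R : Subalgebra ℂ HInfty) (V : Submodule ℂ HardyTwo) : Prop :=
  ∀ k m : ℕ, ∀ r ∈ R, 1 ≤ hInftyOrd r → ∀ h ∈ nearHomComp V k, ∀ g ∈ V,
    (m : ℕ∞) ≤ (r • h + g).ord → homProj m (r • h + g) ∈ homProj m '' (nearHomComp V m)

/-- `V` is `R` invariant. -/
def IsInvariantUnder (R : Subalgebra ℂ HInfty) (V : Submodule ℂ HardyTwo) : Prop :=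
  ∀ r ∈ R, ∀ h ∈ V, r • h ∈ V

/-! ### Inner functions -/

/-- `I ∈ H^∞(D)` is an inner function: for almost every `θ` the radial boundary value
`lim_{r → 1⁻} I(r e^{iθ})` exists and has modulus `1`. -/
def IsInnerFunction (I : HInfty) : Prop :=
  ∀ᵐ θ : ℝ, ∃ c : ℂ, ‖c‖ = 1 ∧
    Tendsto (fun r : ℝ => discExt I.1 (r * Complex.exp (θ * Complex.I))) (𝓝[<] 1) (𝓝 c)

/-- The subspace `I · H²` of `H²`. -/
def mulHardy (I : HInfty) : Submodule ℂ HardyTwo where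
  carrier := {h | ∃ f : HardyTwo, h = I • f}
  zero_mem' := ⟨0, (smul_zero I).symm⟩
  add_mem' := by
    rintro _ _ ⟨f, rfl⟩ ⟨g, rfl⟩
    exact ⟨f + g, (smul_add I f g).symm⟩
  smul_mem' := by
    rintro c _ ⟨f, rfl⟩
    exact ⟨c • f, Subtype.ext (mul_smul_comm c I.1 f.toFun).symm⟩

end

noncomputable section

/-! ### Multiplication operators, the shift and point evaluations -/

namespace HardyTwo

/-! Invariance comes from comparing two approximations of `r • h`, for `r ∈ R₁` and `h` in a
component `W_k`. The full projection property builds, one order at a time, `s ∈ V` with `r • h - s`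
vanishing to order `m`. Near innerness makes this difference orthogonal to every `W_i` with `i < m`.
The difference of `r • h` and its projection to `V` is orthogonal to these `W_i` too. So the
projection minus `s` is an element of `V` orthogonal to `W_0, …, W_{m-1}`, hence has order at least
`m`. Thus `r • h` and its projection agree to every order and are equal
(`smul_mem_of_mem_nearHomComp`). Closedness of `V` passes from the `W_k` to `V`, and `R` is `R₁`
plus the constants.

Beurling's theorem is proved through wandering vectors. Multiplication by `z` is an isometry, and no
nonzero function is infinitely divisible by `z`, so `V ⊖ zV` contains a unit vector `φ`. The `zⁿφ`
are orthonormal, so multiplication by `φ` is an isometry of `H²` (`exists_isometric_mul`). The norms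
of the powers of `φ` then give `|φ| ≤ 1`, and Fatou's theorem together with `‖φ‖ = 1` gives boundary
values of modulus `1`. The wandering space is a line: for orthogonal wandering vectors `φ` and `g`,
the spaces `φH²` and `gH²` would be orthogonal and yet share `φg`. Finally `V ⊖ φH²` is contained in
`z` times itself, hence is zero.

Fatou's theorem is proved from a primitive of the function. It is Lipschitz up to the circle, so its
boundary restriction is differentiable almost everywhere, and tangential differentiability at a
point forces a radial limit of the derivative there.

Conversely, an inner `I` preserves the norms of `1 + c zⁿ`. Polarization makes `I` orthogonal to its
shifts, so multiplication by `I` is an isometry and its range is closed. -/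

theorem norm_coeff_le (f : HardyTwo) (n : ℕ) : ‖taylorCoeff f.toFun n‖ ≤ ‖f‖ := by
  rw [norm_eq, ← toSeq_apply]
  exact lp.norm_apply_le_norm two_ne_zero (toSeq f) n

theorem natCast_le_ord_iff (f : HardyTwo) (n : ℕ) :
    (n : ℕ∞) ≤ f.ord ↔ ∀ i < n, taylorCoeff f.toFun i = 0 :=
  f.analytic.le_discOrd_iff n

theorem eq_zero_of_forall_le_ord {f : HardyTwo} (h : ∀ n : ℕ, (n : ℕ∞) ≤ f.ord) : f = 0 := by
  apply toSeq_injective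
  ext n
  rw [toSeq_apply, (f.natCast_le_ord_iff (n + 1)).1 (h (n + 1)) n n.lt_succ_self, map_zero]
  rfl

/-- Evaluation at a point of the disc. -/
def evalL (z : 𝔻) : HardyTwo →L[ℂ] ℂ :=
  LinearMap.mkContinuous
    { toFun := fun f => f.toFun z
      map_add' := fun _ _ => rfl
      map_smul' := fun _ _ => rfl } (1 - ‖(z : ℂ)‖)⁻¹ fun f => by
    have hz : (z : ℂ) ∈ Metric.ball (0 : ℂ) 1 := mem_ball_zero_iff.2 z.norm_lt_one
    have hs := f.analytic.hasSum hz
    rw [discExt_coe] at hs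
    have hg := (hasSum_geometric_of_lt_one (norm_nonneg (z : ℂ)) z.norm_lt_one).mul_right ‖f‖
    change ‖f.toFun z‖ ≤ _
    rw [← hs.tsum_eq]
    refine tsum_of_norm_bounded hg fun n => ?_
    rw [norm_mul, norm_pow, mul_comm]
    exact mul_le_mul_of_nonneg_left (f.norm_coeff_le n) (by positivity)

theorem evalL_apply (z : 𝔻) (f : HardyTwo) : evalL z f = f.toFun z := rfl

theorem norm_apply_le (f : HardyTwo) (z : 𝔻) : ‖f.toFun z‖ ≤ (1 - ‖(z : ℂ)‖)⁻¹ * ‖f‖ := by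
  rw [← evalL_apply]
  exact ((evalL z).le_opNorm f).trans (mul_le_mul_of_nonneg_right
    (LinearMap.mkContinuous_norm_le _ (inv_nonneg.2 (by linarith [z.norm_lt_one])) _)
    (norm_nonneg _))

/-- The square means over circles converge to the squared norm. -/
theorem tendsto_circleMean (f : HardyTwo) :
    Tendsto (circleMean f.toFun) (𝓝[<] 1) (𝓝 (‖f‖ ^ 2)) := by
  rw [norm_sq_eq_tsum]
  have hev : ∀ᶠ r : ℝ in 𝓝[<] 1, r ∈ Set.Ioo (0 : ℝ) 1 := Ioo_mem_nhdsLT zero_lt_one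
  have : Tendsto (fun r : ℝ => ∑' n, ‖taylorCoeff f.toFun n‖ ^ 2 * r ^ (2 * n)) (𝓝[<] 1)
      (𝓝 (∑' n, ‖taylorCoeff f.toFun n‖ ^ 2)) := by
    refine tendsto_tsum_of_dominated_convergence f.summable (fun n => ?_) ?_
    · have h : Continuous fun r : ℝ => ‖taylorCoeff f.toFun n‖ ^ 2 * r ^ (2 * n) := by fun_prop
      have := h.tendsto 1
      simp only [one_pow, mul_one] at this
      exact this.mono_left nhdsWithin_le_nhds
    · filter_upwards [hev] with r hr n
      rw [Real.norm_of_nonneg (mul_nonneg (by positivity) (pow_nonneg hr.1.le _))]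
      exact mul_le_of_le_one_right (by positivity) (pow_le_one₀ hr.1.le hr.2.le)
  refine this.congr' ?_
  filter_upwards [hev] with r hr
  exact (f.analytic.hasSum_circleMean hr.1.le hr.2).tsum_eq

end HardyTwo

/-- The pointwise bound compares the square means on each circle of radius `s < 1`; both sides
converge to squared norms as `s` tends to `1`. -/
theorem norm_hsmul_le {r : HInfty} {C : ℝ} (hC : ∀ z, ‖r.1 z‖ ≤ C) (f : HardyTwo) :
    ‖r • f‖ ≤ C * ‖f‖ := by
  have hC0 : 0 ≤ C := (norm_nonneg _).trans (hC 0)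
  refine le_of_sq_le_sq ?_ (by positivity)
  refine le_of_tendsto_of_tendsto (r • f).tendsto_circleMean
    ((f.tendsto_circleMean.const_mul (C ^ 2)).trans (by rw [mul_pow])) ?_
  filter_upwards [Ioo_mem_nhdsLT (zero_lt_one : (0 : ℝ) < 1)] with s hs
  have h0 := hs.1.le
  have h1 := hs.2
  have hc : ∀ {g : 𝔻 → ℂ}, AnalyticOnDisc g →
      CircleIntegrable (fun z => ‖discExt g z‖ ^ 2) 0 s := fun {g} hg =>
    ContinuousOn.circleIntegrable' <|
      ((DifferentiableOn.continuousOn hg).mono fun _ hz => circle_mem_ball h0 h1 hz).norm.pow 2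
  change Real.circleAverage (fun z => ‖discExt (r.1 * f.toFun) z‖ ^ 2) 0 s ≤
    C ^ 2 • Real.circleAverage (fun z => ‖discExt f.toFun z‖ ^ 2) 0 s
  rw [← Real.circleAverage_fun_smul]
  refine Real.circleAverage_mono (hc (r • f).analytic) ((hc f.analytic).const_mul _) ?_
  intro z hz
  have hz' := mem_ball_zero_iff.1 (circle_mem_ball h0 h1 hz)
  rw [discExt_mul, Pi.mul_apply, norm_mul, mul_pow, smul_eq_mul]
  have : ‖discExt r.1 z‖ ≤ C := by
    simpa [discExt, hz'] using hC (UnitDisc.mk z hz')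
  gcongr

theorem hInfty_exists_bound (r : HInfty) : ∃ C : ℝ, ∀ z, ‖r.1 z‖ ≤ C := r.2.2

/-- Multiplication by a bounded analytic function, as a continuous linear map. -/
def mulL (r : HInfty) : HardyTwo →L[ℂ] HardyTwo :=
  LinearMap.mkContinuous
    { toFun := fun f => r • f
      map_add' := smul_add r
      map_smul' := fun c f => Subtype.ext (mul_smul_comm c r.1 f.toFun) }
    (hInfty_exists_bound r).choose (norm_hsmul_le (hInfty_exists_bound r).choose_spec)

theorem mulL_apply (r : HInfty) (f : HardyTwo) : mulL r f = r • f := rfl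

theorem hsmul_comm (r s : HInfty) (f : HardyTwo) : r • s • f = s • r • f := by
  rw [← mul_smul, ← mul_smul, mul_comm]

theorem AnalyticOnDisc.taylorCoeff_eq_of_hasSum {f : 𝔻 → ℂ} (hf : AnalyticOnDisc f) {c : ℕ → ℂ}
    (hc : ∀ z ∈ Metric.ball (0 : ℂ) 1, HasSum (fun n => c n * z ^ n) (discExt f z)) (n : ℕ) :
    taylorCoeff f n = c n := by
  have key : ∀ {c : ℕ → ℂ},
      (∀ z ∈ Metric.ball (0 : ℂ) 1, HasSum (fun n => c n * z ^ n) (discExt f z)) →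
      HasFPowerSeriesAt (discExt f) (FormalMultilinearSeries.ofScalars ℂ c) 0 := by
    intro c hc
    rw [hasFPowerSeriesAt_iff]
    filter_upwards [Metric.ball_mem_nhds (0 : ℂ) one_pos] with z hz
    simpa [FormalMultilinearSeries.coeff_ofScalars, mul_comm] using hc z hz
  have h := (key fun z hz => hf.hasSum hz).eq_formalMultilinearSeries (key hc)
  exact congrFun (FormalMultilinearSeries.ofScalars_series_injective ℂ ℂ h) n

/-- The `Nat.casesOn` sequence is the coefficient sequence of `f` moved one place to the right, with
`0` in front. -/
theorem AnalyticOnDisc.hasSum_coordZ_mul {f : 𝔻 → ℂ} (hf : AnalyticOnDisc f) {z : ℂ}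
    (hz : z ∈ Metric.ball (0 : ℂ) 1) :
    HasSum (fun n => (Nat.casesOn n 0 (taylorCoeff f) : ℂ) * z ^ n)
      (discExt (coordZ.1 * f) z) := by
  rw [← hasSum_nat_add_iff' 1, discExt_mul]
  have : discExt coordZ.1 z = z := discExt_of id hz
  have h := (hf.hasSum hz).mul_left z
  simp only [Pi.mul_apply, this, Finset.range_one, Finset.sum_singleton]
  have h' : HasSum (fun n => taylorCoeff f n * z ^ (n + 1)) (z * discExt f z) := by
    convert! h using 2
    ring
  convert! h' using 1
  simp

namespace HardyTwo

theorem taylorCoeff_coordZ_smul_zero (f : HardyTwo) : taylorCoeff (coordZ • f).toFun 0 = 0 :=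
  (coordZ • f).analytic.taylorCoeff_eq_of_hasSum (fun _ hz => f.analytic.hasSum_coordZ_mul hz) 0

theorem taylorCoeff_coordZ_smul_succ (f : HardyTwo) (n : ℕ) :
    taylorCoeff (coordZ • f).toFun (n + 1) = taylorCoeff f.toFun n :=
  (coordZ • f).analytic.taylorCoeff_eq_of_hasSum
    (fun _ hz => f.analytic.hasSum_coordZ_mul hz) (n + 1)

/-- Multiplication by the coordinate, as a linear isometry. -/
def shift : HardyTwo →ₗᵢ[ℂ] HardyTwo where
  toLinearMap := (mulL coordZ).toLinearMap
  norm_map' f := by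
    change ‖coordZ • f‖ = ‖f‖
    rw [← sq_eq_sq₀ (norm_nonneg _) (norm_nonneg _), norm_sq_eq_tsum, norm_sq_eq_tsum,
      (coordZ • f).summable.tsum_eq_zero_add, taylorCoeff_coordZ_smul_zero]
    simp [taylorCoeff_coordZ_smul_succ]

theorem shift_apply (f : HardyTwo) : shift f = coordZ • f := rfl

theorem shift_hsmul (r : HInfty) (f : HardyTwo) : shift (r • f) = r • shift f :=
  hsmul_comm coordZ r f

theorem succ_le_ord_shift {f : HardyTwo} {n : ℕ} (h : (n : ℕ∞) ≤ f.ord) :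
    ((n + 1 : ℕ) : ℕ∞) ≤ (shift f).ord := by
  rw [natCast_le_ord_iff] at h ⊢
  rintro (_ | i) hi
  · exact taylorCoeff_coordZ_smul_zero f
  · rw [shift_apply, taylorCoeff_coordZ_smul_succ]
    exact h i (by omega)

/-- The constant function `1`. -/
def one : HardyTwo := ⟨fun _ => 1, AnalyticOnDisc.const 1, 1, fun r h0 h1 => by
  rw [circleMean, Real.circleAverage_congr_sphere (f₂ := fun _ => 1) fun z hz => by
    simp only [discExt_of (fun _ => 1) (circle_mem_ball h0 h1 hz), norm_one, one_pow]]
  simp [Real.circleAverage_const]⟩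

theorem one_toFun (z : 𝔻) : one.toFun z = 1 := rfl

theorem taylorCoeff_one (n : ℕ) : taylorCoeff one.toFun n = if n = 0 then 1 else 0 := by
  refine one.analytic.taylorCoeff_eq_of_hasSum (c := fun n => if n = 0 then 1 else 0)
    (fun z hz => ?_) n
  have h1 : discExt one.toFun z = 1 := discExt_of (fun _ => 1) hz
  rw [h1]
  convert! hasSum_ite_eq (0 : ℕ) (1 : ℂ) using 2 with n
  split_ifs with hn <;> simp [hn]

theorem norm_one : ‖one‖ = 1 := by
  rw [← sq_eq_sq₀ (norm_nonneg _) zero_le_one, norm_sq_eq_tsum, tsum_eq_single 0]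
  · simp [taylorCoeff_one]
  · intro n hn; simp [taylorCoeff_one, hn]

theorem inner_one_shift (f : HardyTwo) : inner ℂ one (shift f) = 0 := by
  change inner ℂ (toSeq one) (toSeq (shift f)) = 0
  rw [lp.inner_eq_tsum]
  refine (tsum_congr fun n => ?_).trans tsum_zero
  rw [toSeq_apply, toSeq_apply, shift_apply]
  rcases n with _ | n
  · rw [taylorCoeff_coordZ_smul_zero, inner_zero_right]
  · rw [taylorCoeff_one, if_neg n.succ_ne_zero, inner_zero_left]

end HardyTwo

/-! ### Near inner decompositions with full projections are invariant -/

theorem mem_valSub {V : Submodule ℂ HardyTwo} {k : ℕ} {h : HardyTwo} :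
    h ∈ valSub V k ↔ h ∈ V ∧ (k : ℕ∞) ≤ h.ord := Iff.rfl

theorem mem_nearHomComp {V : Submodule ℂ HardyTwo} {k : ℕ} {h : HardyTwo} :
    h ∈ nearHomComp V k ↔ h ∈ valSub V k ∧ h ∈ (valSub V (k + 1))ᗮ := Iff.rfl

theorem isClosed_valSub {V : Submodule ℂ HardyTwo} (hV : IsClosed (V : Set HardyTwo)) (k : ℕ) :
    IsClosed (valSub V k : Set HardyTwo) := by
  have : (valSub V k : Set HardyTwo) = (V : Set HardyTwo) ∩ valSub ⊤ k := by
    ext h; simp [mem_valSub]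
  rw [this]
  exact hV.inter (isClosed_valSub_top k)

theorem valSub_succ_le (V : Submodule ℂ HardyTwo) (k : ℕ) : valSub V (k + 1) ≤ valSub V k :=
  fun _ hx => ⟨hx.1, le_trans (by exact_mod_cast k.le_succ) hx.2⟩

/-- This is `V_k = W_k ⊕ V_{k+1}`: the part of `x` off `V_{k+1}` lies in `W_k`, so it is orthogonal
both to `x` and to the projection of `x`, hence to itself. -/
theorem mem_valSub_succ {V : Submodule ℂ HardyTwo} (hV : IsClosed (V : Set HardyTwo)) {k : ℕ}
    {x : HardyTwo} (hx : x ∈ valSub V k) (hxW : x ∈ (nearHomComp V k)ᗮ) :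
    x ∈ valSub V (k + 1) := by
  have := (isClosed_valSub hV (k + 1)).completeSpace_coe
  let K := valSub V (k + 1)
  have hp : K.starProjection x ∈ K := K.starProjection_apply_mem x
  have hw : x - K.starProjection x ∈ nearHomComp V k :=
    ⟨sub_mem hx (valSub_succ_le V k hp), K.sub_starProjection_mem_orthogonal x⟩
  have h1 : inner ℂ (x - K.starProjection x) x = 0 := hxW _ hw
  have h2 : inner ℂ (x - K.starProjection x) (K.starProjection x) = 0 :=
    inner_eq_zero_symm.1 (hw.2 _ hp)
  have h3 : inner ℂ (x - K.starProjection x) (x - K.starProjection x) = 0 := by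
    rw [inner_sub_right (x - _), h1, h2, sub_zero]
  rw [inner_self_eq_zero, sub_eq_zero] at h3
  rw [h3]; exact hp

theorem mem_valSub_of_forall_lt {V : Submodule ℂ HardyTwo} (hV : IsClosed (V : Set HardyTwo))
    {k : ℕ} {x : HardyTwo} (hx : x ∈ V) (hxW : ∀ i < k, x ∈ (nearHomComp V i)ᗮ) :
    x ∈ valSub V k := by
  induction k with
  | zero => exact ⟨hx, by simp⟩
  | succ k ih => exact mem_valSub_succ hV (ih fun i hi => hxW i (by omega)) (hxW k k.lt_succ_self)

/-- Among functions of order at least `m`, the kernel of `P_m` consists of those of order at least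
`m + 1`. This is the gain of one order in the successive approximation. -/
theorem succ_le_ord_sub_of_homProj_eq {m : ℕ} {x y : HardyTwo} (hx : (m : ℕ∞) ≤ x.ord)
    (hy : (m : ℕ∞) ≤ y.ord) (h : homProj m x = homProj m y) :
    ((m + 1 : ℕ) : ℕ∞) ≤ (x - y).ord := by
  have hd : x - y ∈ valSub ⊤ m :=
    sub_mem (mem_valSub.2 ⟨trivial, hx⟩) (mem_valSub.2 ⟨trivial, hy⟩)
  refine (mem_valSub_succ isClosed_univ hd ?_).2
  rw [← Submodule.starProjection_apply_eq_zero_iff]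
  change homProj m (x - y) = 0
  rw [map_sub, h, sub_self]

/-- The approximants `s` need not converge; they serve only to show that `r • h` and its projection
to `V` agree to every finite order. -/
theorem smul_mem_of_mem_nearHomComp {R : Subalgebra ℂ HInfty} {V : Submodule ℂ HardyTwo}
    (hV : IsClosed (V : Set HardyTwo)) (hN : IsNearInner R V) (hF : HasFullProjection R V)
    {k : ℕ} {h : HardyTwo} (hh : h ∈ nearHomComp V k) {r : HInfty} (hr : r ∈ R)
    (hr1 : 1 ≤ hInftyOrd r) : r • h ∈ V := by
  have happrox : ∀ m : ℕ, ∃ s ∈ V, (m : ℕ∞) ≤ (r • h - s).ord := by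
    intro m
    induction m with
    | zero => exact ⟨0, V.zero_mem, by simp⟩
    | succ m ih =>
      obtain ⟨s, hs, hm⟩ := ih
      rw [sub_eq_add_neg] at hm
      obtain ⟨w, hw, hwe⟩ := hF k m r hr hr1 h hh (-s) (V.neg_mem hs) hm
      refine ⟨s + w, V.add_mem hs hw.1.1, ?_⟩
      have := succ_le_ord_sub_of_homProj_eq hm hw.1.2 hwe.symm
      rwa [show r • h - (s + w) = r • h + -s - w by abel]
  have := hV.completeSpace_coe
  have hzero : r • h - V.starProjection (r • h) = 0 := by
    refine HardyTwo.eq_zero_of_forall_le_ord fun m => ?_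
    obtain ⟨s, hs, hm⟩ := happrox m
    -- Both `r • h - s` (near innerness) and `r • h` minus its projection (`W_i ≤ V`) are orthogonal
    -- to `W_i` for `i < m`; their difference lies in `V`.
    have hd : V.starProjection (r • h) - s ∈ valSub V m := by
      refine mem_valSub_of_forall_lt hV (V.sub_mem (V.starProjection_apply_mem _) hs) ?_
      intro i hi
      have h1 : r • h - s ∈ (nearHomComp V i)ᗮ := by
        rw [sub_eq_add_neg] at hm ⊢
        exact hN k i h hh (-s) (V.neg_mem hs) r hr hr1
          (lt_of_lt_of_le (by exact_mod_cast hi) hm)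
      have h2 : r • h - V.starProjection (r • h) ∈ (nearHomComp V i)ᗮ :=
        Submodule.orthogonal_le (fun _ hx => (mem_nearHomComp.1 hx).1.1) (V.sub_starProjection_mem_orthogonal _)
      have := sub_mem h1 h2
      rwa [show r • h - s - (r • h - V.starProjection (r • h)) = V.starProjection (r • h) - s
        by abel] at this
    have h3 : r • h - s ∈ valSub ⊤ m := mem_valSub.2 ⟨trivial, hm⟩
    have h4 : V.starProjection (r • h) - s ∈ valSub ⊤ m := mem_valSub.2 ⟨trivial, hd.2⟩
    have h5 := sub_mem h3 h4
    rw [show r • h - s - (V.starProjection (r • h) - s) = r • h - V.starProjection (r • h)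
      by abel] at h5
    exact h5.2
  rw [sub_eq_zero.1 hzero]
  exact V.starProjection_apply_mem _

/-- The elements of `V` that `r` keeps in `V` form a closed subspace containing every `W_i`. An
element of `V` orthogonal to all `W_i` has infinite order, so that subspace is `V`. -/
theorem smul_mem_of_nearInner {R : Subalgebra ℂ HInfty} {V : Submodule ℂ HardyTwo}
    (hV : IsClosed (V : Set HardyTwo)) (hN : IsNearInner R V) (hF : HasFullProjection R V)
    {r : HInfty} (hr : r ∈ R) (hr1 : 1 ≤ hInftyOrd r) {h : HardyTwo} (hh : h ∈ V) :
    r • h ∈ V := by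
  let U : Submodule ℂ HardyTwo := V ⊓ V.comap (mulL r).toLinearMap
  have hU : IsClosed (U : Set HardyTwo) := hV.inter (hV.preimage (mulL r).continuous)
  have := hU.completeSpace_coe
  have hd : h - U.starProjection h ∈ V := V.sub_mem hh (U.starProjection_apply_mem h).1
  have horth := U.sub_starProjection_mem_orthogonal h
  have hz : h - U.starProjection h = 0 := by
    refine HardyTwo.eq_zero_of_forall_le_ord fun m =>
      (mem_valSub_of_forall_lt hV hd fun i _ => ?_).2
    have hle : nearHomComp V i ≤ U := fun x hx =>
      ⟨(mem_nearHomComp.1 hx).1.1, smul_mem_of_mem_nearHomComp hV hN hF hx hr hr1⟩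
    exact Submodule.orthogonal_le hle horth
  rw [sub_eq_zero.1 hz]
  exact (U.starProjection_apply_mem h).2

theorem isInvariantUnder_of_nearInner {R : Subalgebra ℂ HInfty} {V : Submodule ℂ HardyTwo}
    (hV : IsClosed (V : Set HardyTwo)) (hN : IsNearInner R V) (hF : HasFullProjection R V) :
    IsInvariantUnder R V := by
  intro r hr h hh
  let c : ℂ := taylorCoeff r.1 0
  have hmem : r - algebraMap ℂ HInfty c ∈ R := R.sub_mem hr (R.algebraMap_mem c)
  -- Subtracting the value of `r` at `0` leaves an element of `R₁`; the constant acts as a scalar.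
  have hord : 1 ≤ hInftyOrd (r - algebraMap ℂ HInfty c) := by
    have := ((r - algebraMap ℂ HInfty c).2.1.le_discOrd_iff 1).2 (by
      intro i hi
      obtain rfl : i = 0 := by omega
      have h0 : (0 : ℂ) = ((0 : 𝔻) : ℂ) := rfl
      simp only [taylorCoeff, iteratedDeriv_zero]
      rw [h0, discExt_coe]
      change _ * (r.1 0 - c) = 0
      simp only [c, taylorCoeff, iteratedDeriv_zero]
      rw [h0, discExt_coe]
      simp)
    exact_mod_cast this
  have h1 := smul_mem_of_nearInner hV hN hF hmem hord hh
  have h2 : algebraMap ℂ HInfty c • h = c • h := rfl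
  rw [sub_smul, h2] at h1
  exact (Submodule.sub_mem_iff_left V (V.smul_mem c hh)).1 h1

/-! ### Fatou's theorem on radial limits of bounded analytic functions -/

theorem norm_circleAverage_le_of_norm_le {F : ℂ → ℂ} {B : ℂ → ℝ} {c : ℂ} {R : ℝ}
    (hB : CircleIntegrable B c R) (h : ∀ z ∈ Metric.sphere c |R|, ‖F z‖ ≤ B z) :
    ‖Real.circleAverage F c R‖ ≤ Real.circleAverage B c R := by
  rw [Real.circleAverage_def, Real.circleAverage_def, norm_smul, smul_eq_mul,
    Real.norm_of_nonneg (by positivity)]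
  refine mul_le_mul_of_nonneg_left ?_ (by positivity)
  exact intervalIntegral.norm_integral_le_of_norm_le (by positivity)
    (Eventually.of_forall fun θ _ => h _ (circleMap_mem_sphere' c R θ)) hB

/-- Cauchy's formula for the divided difference `dslope e z`, whose value at `z` is the derivative.
Its constant term drops out because `(ζ - z)⁻²` integrates to zero over the circle. -/
theorem DiffContOnCl.deriv_eq_circleIntegral {e : ℂ → ℂ} {c z : ℂ} {R : ℝ}
    (he : DiffContOnCl ℂ e (Metric.ball c R)) (hz : z ∈ Metric.ball c R) :
    (2 * Real.pi * I : ℂ)⁻¹ • (∮ ζ in C(c, R), ((ζ - z) ^ 2)⁻¹ • e ζ) = deriv e z := by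
  have hR := Metric.pos_of_mem_ball hz
  have hnhds : Metric.ball c R ∈ 𝓝 z := Metric.isOpen_ball.mem_nhds hz
  have hcl : closure (Metric.ball c R) ∈ 𝓝 z := mem_of_superset hnhds subset_closure
  have hd : DiffContOnCl ℂ (dslope e z) (Metric.ball c R) :=
    ⟨(differentiableOn_dslope hnhds).2 he.1,
      (continuousOn_dslope hcl).2 ⟨he.2, he.1.differentiableAt hnhds⟩⟩
  have h0 := hd.two_pi_i_inv_smul_circleIntegral_sub_inv_smul hz
  rw [dslope_same] at h0
  rw [← h0]
  congr 1
  have hsph : Metric.sphere c R ⊆ closure (Metric.ball c R) := by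
    rw [closure_ball c hR.ne']; exact Metric.sphere_subset_closedBall
  have h1 : ContinuousOn (fun ζ : ℂ => ((ζ - z) ^ 2)⁻¹) (Metric.sphere c R) := by
    refine ((continuous_id'.sub continuous_const).pow 2).continuousOn.inv₀ fun w hw h => ?_
    exact Metric.sphere_disjoint_ball.ne_of_mem hw hz (sub_eq_zero.mp (sq_eq_zero_iff.mp h))
  have h2 : CircleIntegrable (fun ζ : ℂ => ((ζ - z) ^ 2)⁻¹ • e ζ) c R :=
    ContinuousOn.circleIntegrable hR.le (h1.smul (he.2.mono hsph))
  have h3 : CircleIntegrable (fun ζ : ℂ => ((ζ - z) ^ 2)⁻¹ • e z) c R :=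
    ContinuousOn.circleIntegrable hR.le (h1.smul continuousOn_const)
  have h4 : (∮ ζ : ℂ in C(c, R), ((ζ - z) ^ 2)⁻¹) = 0 := by
    simpa using! circleIntegral.integral_sub_zpow_of_ne (by decide : (-2 : ℤ) ≠ -1) c z R
  trans ∮ ζ in C(c, R), ((ζ - z) ^ 2)⁻¹ • (e ζ - e z)
  · simp only [smul_sub, circleIntegral.integral_sub h2 h3, h4, circleIntegral.integral_smul_const,
      zero_smul, sub_zero]
  · refine circleIntegral.integral_congr hR.le fun ζ hζ => ?_
    simp only [dslope_of_ne, Metric.sphere_disjoint_ball.ne_of_mem hζ hz, slope, sq, mul_inv,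
      Ne, not_false_iff, vsub_eq_sub, smul_eq_mul, mul_assoc]

/-- The derivative of an analytic function at `z`, with a kernel that also has a pole at a point
`w` outside the closed disc. -/
theorem DiffContOnCl.deriv_eq_circleAverage {e : ℂ → ℂ} {z w : ℂ}
    (he : DiffContOnCl ℂ e (Metric.ball 0 1)) (hz : z ∈ Metric.ball (0 : ℂ) 1) (hw : 1 < ‖w‖) :
    deriv e z =
      Real.circleAverage (fun ζ => ζ * ((((ζ - z) ^ 2)⁻¹ - ((ζ - w) ^ 2)⁻¹) * e ζ)) 0 1 := by
  have hsph : Metric.sphere (0 : ℂ) 1 ⊆ closure (Metric.ball 0 1) := by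
    rw [closure_ball (0 : ℂ) one_ne_zero]; exact Metric.sphere_subset_closedBall
  have hne : ∀ ζ ∈ closure (Metric.ball (0 : ℂ) 1), (ζ - w) ^ 2 ≠ 0 := by
    intro ζ hζ h
    rw [closure_ball (0 : ℂ) one_ne_zero, mem_closedBall_zero_iff] at hζ
    rw [sub_eq_zero.1 (sq_eq_zero_iff.1 h)] at hζ
    linarith
  have hcw : ContinuousOn (fun ζ => ((ζ - w) ^ 2)⁻¹ * e ζ) (closure (Metric.ball 0 1)) :=
    (ContinuousOn.inv₀ (by fun_prop) hne).mul he.2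
  have h0 : (∮ ζ in C(0, 1), ((ζ - w) ^ 2)⁻¹ * e ζ) = 0 := by
    refine DiffContOnCl.circleIntegral_eq_zero zero_le_one ⟨?_, hcw⟩
    exact (DifferentiableOn.inv (by fun_prop) fun ζ hζ => hne ζ (subset_closure hζ)).mul he.1
  have hcz : ContinuousOn (fun ζ => ((ζ - z) ^ 2)⁻¹ * e ζ) (Metric.sphere 0 1) := by
    refine (ContinuousOn.inv₀ (by fun_prop) fun ζ hζ h => ?_).mul (he.2.mono hsph)
    exact Metric.sphere_disjoint_ball.ne_of_mem hζ hz (sub_eq_zero.mp (sq_eq_zero_iff.mp h))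
  -- As a contour integral the circle average carries a factor `ζ⁻¹`, which the factor `ζ` in the
  -- integrand cancels.
  rw [Real.circleAverage_eq_circleIntegral one_ne_zero, ← he.deriv_eq_circleIntegral hz]
  congr 1
  trans ∮ ζ in C(0, 1), (((ζ - z) ^ 2)⁻¹ * e ζ - ((ζ - w) ^ 2)⁻¹ * e ζ)
  · rw [circleIntegral.integral_sub (hcz.circleIntegrable zero_le_one)
      ((hcw.mono hsph).circleIntegrable zero_le_one), h0, sub_zero]
    rfl
  · refine circleIntegral.integral_congr zero_le_one fun ζ hζ => ?_
    have : ζ ≠ 0 := Metric.ne_of_mem_sphere hζ one_ne_zero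
    simp only [sub_zero, smul_eq_mul]
    rw [inv_mul_cancel_left₀ this, sub_mul]

/-- For unit `ζ` and `ζ₀`, `|rζ - ζ₀|` and `|ζ - rζ₀|` have the same square, so the distances from
`ζ` to `rζ₀` and to its reflection in the circle have constant ratio. -/
theorem norm_sub_reflection {ζ ζ₀ : ℂ} (hζ : ‖ζ‖ = 1) (hζ₀ : ‖ζ₀‖ = 1) {r : ℝ} (hr : 0 < r) :
    ‖ζ - (r : ℂ)⁻¹ * ζ₀‖ = ‖ζ - r * ζ₀‖ / r := by
  have hsq : ‖r * ζ - ζ₀‖ = ‖ζ - r * ζ₀‖ := by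
    rw [← sq_eq_sq₀ (norm_nonneg _) (norm_nonneg _), @norm_sub_sq_real ℂ, @norm_sub_sq_real ℂ,
      norm_mul, norm_mul, hζ, hζ₀, Complex.norm_real, ← Complex.real_smul, ← Complex.real_smul,
      real_inner_smul_left, real_inner_smul_right]
    ring
  have hr' : (r : ℂ) ≠ 0 := by exact_mod_cast hr.ne'
  rw [← hsq, show ζ - (r : ℂ)⁻¹ * ζ₀ = (r : ℂ)⁻¹ * (r * ζ - ζ₀) by field_simp, norm_mul, norm_inv,
    Complex.norm_real, Real.norm_of_nonneg hr.le]
  ring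

/-- The reason for subtracting the reflected pole: `|ζ - rζ₀|⁻² |ζ - ζ₀|` alone has mean growing
like `log (1 / (1 - r))`, while the difference gains a factor `1 - r²` and is dominated by the
Poisson kernel, whose mean is `1`. -/
theorem norm_kernel_le {ζ ζ₀ : ℂ} (hζ : ‖ζ‖ = 1) (hζ₀ : ‖ζ₀‖ = 1) {r : ℝ} (hr : 0 < r)
    (hr1 : r < 1) :
    ‖((ζ - r * ζ₀) ^ 2)⁻¹ - ((ζ - (r : ℂ)⁻¹ * ζ₀) ^ 2)⁻¹‖ * ‖ζ - ζ₀‖ ≤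
      4 * poissonKernel 0 (r * ζ₀) ζ := by
  have hrz : ‖(r : ℂ) * ζ₀‖ = r := by
    rw [norm_mul, hζ₀, Complex.norm_real, Real.norm_of_nonneg hr.le, mul_one]
  have hr' : (r : ℂ) ≠ 0 := by exact_mod_cast hr.ne'
  set d := ‖ζ - r * ζ₀‖ with hd
  have hd1 : 1 - r ≤ d := by
    have := norm_sub_norm_le ζ (r * ζ₀)
    rwa [hζ, hrz] at this
  have hd0 : 0 < d := by linarith
  have hw : ‖ζ - (r : ℂ)⁻¹ * ζ₀‖ = d / r := norm_sub_reflection hζ hζ₀ hr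
  have hz0 : ζ - r * ζ₀ ≠ 0 := norm_pos_iff.1 hd0
  have hw0 : ζ - (r : ℂ)⁻¹ * ζ₀ ≠ 0 := norm_pos_iff.1 (by rw [hw]; positivity)
  have hzz : ‖ζ - ζ₀‖ ≤ 2 * d := by
    have h1 : ‖ζ - ζ₀‖ ≤ ‖ζ - r * ζ₀‖ + ‖r * ζ₀ - ζ₀‖ := norm_sub_le_norm_sub_add_norm_sub _ _ _
    have h2 : ‖r * ζ₀ - ζ₀‖ = 1 - r := by
      rw [show (r : ℂ) * ζ₀ - ζ₀ = ((r - 1 : ℝ) : ℂ) * ζ₀ by push_cast; ring, norm_mul, hζ₀,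
        Complex.norm_real, Real.norm_of_nonpos (by linarith)]
      ring
    linarith
  -- With `a = ζ - rζ₀` and `b = ζ - ζ₀/r`, this is `a⁻² - b⁻² = (b - a)(a + b) / (a²b²)`. Here `|b
  -- - a| = (1 - r²)/r` and `|b| = |a|/r`.
  have hker : ((ζ - r * ζ₀) ^ 2)⁻¹ - ((ζ - (r : ℂ)⁻¹ * ζ₀) ^ 2)⁻¹ =
      ((r * ζ₀ - (r : ℂ)⁻¹ * ζ₀) * ((ζ - r * ζ₀) + (ζ - (r : ℂ)⁻¹ * ζ₀))) /
        ((ζ - r * ζ₀) ^ 2 * (ζ - (r : ℂ)⁻¹ * ζ₀) ^ 2) := by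
    rw [inv_sub_inv (pow_ne_zero 2 hz0) (pow_ne_zero 2 hw0)]
    congr 1
    ring
  have h3 : ‖r * ζ₀ - (r : ℂ)⁻¹ * ζ₀‖ = (1 - r ^ 2) / r := by
    rw [show (r : ℂ) * ζ₀ - (r : ℂ)⁻¹ * ζ₀ = ((r - r⁻¹ : ℝ) : ℂ) * ζ₀ by push_cast; ring, norm_mul,
      hζ₀, Complex.norm_real, Real.norm_of_nonpos]
    · field_simp; ring
    · have := one_le_inv₀ hr |>.2 hr1.le
      linarith
  have h4 : ‖(ζ - r * ζ₀) + (ζ - (r : ℂ)⁻¹ * ζ₀)‖ ≤ d + d / r := by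
    rw [← hw]; exact norm_add_le _ _
  have hr2 : 0 ≤ 1 - r ^ 2 := by nlinarith
  rw [hker, norm_div, norm_mul, norm_mul, norm_pow, norm_pow, h3, hw, poissonKernel_def]
  simp only [sub_zero]
  rw [hζ, hrz, ← hd]
  calc (1 - r ^ 2) / r * ‖(ζ - r * ζ₀) + (ζ - (r : ℂ)⁻¹ * ζ₀)‖ / (d ^ 2 * (d / r) ^ 2) * ‖ζ - ζ₀‖
      ≤ (1 - r ^ 2) / r * (d + d / r) / (d ^ 2 * (d / r) ^ 2) * (2 * d) := by gcongr
    _ = 2 * (1 + r) * ((1 ^ 2 - r ^ 2) / d ^ 2) := by field_simp; ring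
    _ ≤ 4 * ((1 ^ 2 - r ^ 2) / d ^ 2) := by
      gcongr
      · rw [one_pow]; positivity
      · linarith

/-- An approximate identity argument. Near `ζ₀` the smallness of `e` meets a kernel of mean at most
`4`; away from `ζ₀` the Poisson kernel tends uniformly to zero as `r` tends to `1`. -/
theorem DiffContOnCl.tendsto_deriv_radial_zero {e : ℂ → ℂ} {ζ₀ : ℂ} {M : ℝ}
    (he : DiffContOnCl ℂ e (Metric.ball 0 1)) (hζ₀ : ‖ζ₀‖ = 1)
    (hM : ∀ ζ : ℂ, ‖ζ‖ = 1 → ‖e ζ‖ ≤ M * ‖ζ - ζ₀‖)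
    (ho : ∀ ε > 0, ∃ δ > 0, ∀ ζ : ℂ, ‖ζ‖ = 1 → ‖ζ - ζ₀‖ < δ → ‖e ζ‖ ≤ ε * ‖ζ - ζ₀‖) :
    Tendsto (fun r : ℝ => deriv e (r * ζ₀)) (𝓝[<] 1) (𝓝 0) := by
  have hM0 : 0 ≤ M := by
    -- Evaluating the bound at the antipode of `ζ₀` gives `0 ≤ 2M`.
    have := (norm_nonneg _).trans (hM (-ζ₀) (by simpa using hζ₀))
    have h2 : ‖-ζ₀ - ζ₀‖ = 2 := by
      rw [show -ζ₀ - ζ₀ = (-2 : ℝ) * ζ₀ by push_cast; ring, norm_mul, hζ₀, Complex.norm_real]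
      norm_num
    rw [h2] at this
    linarith
  rw [NormedAddGroup.tendsto_nhds_zero]
  intro ε hε
  -- With the kernel constant `4`, the near part contributes `ε / 2`, which leaves room for the far
  -- part.
  obtain ⟨δ, hδ, hδe⟩ := ho (ε / 8) (by positivity)
  have hlim : Tendsto (fun r : ℝ => 4 * (ε / 8 + M * ((1 - r ^ 2) / (δ / 2) ^ 2))) (𝓝[<] 1)
      (𝓝 (4 * (ε / 8 + M * ((1 - 1 ^ 2) / (δ / 2) ^ 2)))) := by
    have : Continuous fun r : ℝ => 4 * (ε / 8 + M * ((1 - r ^ 2) / (δ / 2) ^ 2)) := by fun_prop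
    exact (this.tendsto 1).mono_left nhdsWithin_le_nhds
  have hev : ∀ᶠ r : ℝ in 𝓝[<] 1, 4 * (ε / 8 + M * ((1 - r ^ 2) / (δ / 2) ^ 2)) < ε := by
    refine hlim.eventually_lt_const ?_
    norm_num
    linarith
  filter_upwards [hev, Ioo_mem_nhdsLT (zero_lt_one : (0 : ℝ) < 1)] with r hr ⟨hr0, hr1⟩
  refine lt_of_le_of_lt ?_ hr
  have hrz : ‖(r : ℂ) * ζ₀‖ = r := by
    rw [norm_mul, hζ₀, Complex.norm_real, Real.norm_of_nonneg hr0.le, mul_one]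
  have hz : (r : ℂ) * ζ₀ ∈ Metric.ball (0 : ℂ) 1 := by
    rw [mem_ball_zero_iff, hrz]; exact hr1
  have hw : 1 < ‖(r : ℂ)⁻¹ * ζ₀‖ := by
    rw [norm_mul, hζ₀, norm_inv, Complex.norm_real, Real.norm_of_nonneg hr0.le, mul_one]
    exact (one_lt_inv₀ hr0).2 hr1
  have hPc : ContinuousOn (poissonKernel 0 (r * ζ₀)) (Metric.sphere 0 1) := by
    unfold poissonKernel
    refine ContinuousOn.div (by fun_prop) (by fun_prop) fun ζ hζ h => ?_
    have h' := norm_eq_zero.1 (sq_eq_zero_iff.1 h)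
    rw [sub_zero, sub_zero] at h'
    exact Metric.sphere_disjoint_ball.ne_of_mem hζ hz (sub_eq_zero.1 h')
  have hPi : CircleIntegrable (poissonKernel 0 (r * ζ₀)) 0 1 := hPc.circleIntegrable zero_le_one
  -- The Poisson kernel reproduces the constant function `1`; the complex identity is then read in
  -- the reals.
  have hP1 : Real.circleAverage (poissonKernel 0 (r * ζ₀)) 0 1 = 1 := by
    have h1 := DiffContOnCl.circleAverage_poissonKernel_smul
      (diffContOnCl_const (c := (1 : ℂ))) hz
    have h2 := Complex.ofRealCLM.circleAverage_comp_comm hPi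
    have h3 : poissonKernel 0 (r * ζ₀) • (fun _ => (1 : ℂ)) =
        Complex.ofRealCLM ∘ poissonKernel 0 (r * ζ₀) := by
      ext ζ; simp
    rw [h3, h2] at h1
    rw [ofRealCLM_apply] at h1
    exact_mod_cast h1
  have hr2 : 0 ≤ 1 - r ^ 2 := by nlinarith
  have hP0 : ∀ ζ : ℂ, ‖ζ‖ = 1 → 0 ≤ poissonKernel 0 (r * ζ₀) ζ := by
    intro ζ hζ
    rw [poissonKernel_def, sub_zero, sub_zero, hζ, hrz, one_pow]
    positivity
  set c : ℝ := M * ((1 - r ^ 2) / (δ / 2) ^ 2) with hc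
  have hc0 : 0 ≤ c := by positivity
  have hbound : ∀ ζ ∈ Metric.sphere (0 : ℂ) |1|,
      ‖ζ * ((((ζ - r * ζ₀) ^ 2)⁻¹ - ((ζ - (r : ℂ)⁻¹ * ζ₀) ^ 2)⁻¹) * e ζ)‖ ≤
        4 * (ε / 8 * poissonKernel 0 (r * ζ₀) ζ + c) := by
    intro ζ hζ
    rw [mem_sphere_zero_iff_norm, abs_one] at hζ
    have hk := norm_kernel_le hζ hζ₀ hr0 hr1
    have hp := hP0 ζ hζ
    rw [norm_mul, hζ, one_mul, norm_mul]
    set K := ‖((ζ - r * ζ₀) ^ 2)⁻¹ - ((ζ - (r : ℂ)⁻¹ * ζ₀) ^ 2)⁻¹‖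
    have hK : 0 ≤ K := norm_nonneg _
    rcases lt_or_ge ‖ζ - ζ₀‖ δ with hlt | hge
    · have := hδe ζ hζ hlt
      calc K * ‖e ζ‖ ≤ K * (ε / 8 * ‖ζ - ζ₀‖) := by gcongr
        _ = ε / 8 * (K * ‖ζ - ζ₀‖) := by ring
        _ ≤ ε / 8 * (4 * poissonKernel 0 (r * ζ₀) ζ) := by gcongr
        _ ≤ _ := by linarith
    -- Since `1 - r ≤ |ζ - rζ₀|`, the distance from `ζ` to `ζ₀` is at most twice its distance to
    -- `rζ₀`.
    · have hdist : δ / 2 ≤ ‖ζ - r * ζ₀‖ := by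
        have h1 : ‖ζ - ζ₀‖ ≤ ‖ζ - r * ζ₀‖ + ‖r * ζ₀ - ζ₀‖ :=
          norm_sub_le_norm_sub_add_norm_sub _ _ _
        have h2 : ‖r * ζ₀ - ζ₀‖ = 1 - r := by
          rw [show (r : ℂ) * ζ₀ - ζ₀ = ((r - 1 : ℝ) : ℂ) * ζ₀ by push_cast; ring, norm_mul, hζ₀,
            Complex.norm_real, Real.norm_of_nonpos (by linarith)]
          ring
        have h3 := norm_sub_norm_le ζ (r * ζ₀)
        rw [hζ, hrz] at h3
        linarith
      have hpk : poissonKernel 0 (r * ζ₀) ζ ≤ (1 - r ^ 2) / (δ / 2) ^ 2 := by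
        rw [poissonKernel_def, sub_zero, sub_zero, hζ, hrz, one_pow]
        gcongr
      calc K * ‖e ζ‖ ≤ K * (M * ‖ζ - ζ₀‖) := by gcongr; exact hM ζ hζ
        _ = M * (K * ‖ζ - ζ₀‖) := by ring
        _ ≤ M * (4 * poissonKernel 0 (r * ζ₀) ζ) := by gcongr
        _ ≤ M * (4 * ((1 - r ^ 2) / (δ / 2) ^ 2)) := by gcongr
        _ = 4 * c := by rw [hc]; ring
        _ ≤ _ := by nlinarith
  rw [he.deriv_eq_circleAverage hz hw]
  have hci : CircleIntegrable (fun _ : ℂ => c) 0 1 := circleIntegrable_const c 0 1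
  have h1 : CircleIntegrable (fun ζ => ε / 8 * poissonKernel 0 (r * ζ₀) ζ) 0 1 :=
    hPi.const_fun_smul
  refine (norm_circleAverage_le_of_norm_le
    (B := fun ζ => 4 * (ε / 8 * poissonKernel 0 (r * ζ₀) ζ + c)) ?_ hbound).trans (le_of_eq ?_)
  · exact (h1.add hci).const_fun_smul
  · have e1 := Real.circleAverage_fun_smul (a := (4 : ℝ)) (c := (0 : ℂ)) (R := 1)
      (f := fun ζ => ε / 8 * poissonKernel 0 (r * ζ₀) ζ + c)
    have e2 := Real.circleAverage_fun_smul (a := ε / 8) (c := (0 : ℂ)) (R := 1)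
      (f := poissonKernel 0 (r * ζ₀))
    simp only [smul_eq_mul] at e1 e2
    rw [e1, Real.circleAverage_fun_add h1 hci, e2, hP1, Real.circleAverage_const, mul_one]

/-- **Fatou's theorem**: a bounded analytic function on the unit disc has radial limits almost
everywhere. -/
theorem ae_exists_radial_limit {f : ℂ → ℂ} (hf : DifferentiableOn ℂ f (Metric.ball 0 1)) {C : ℝ}
    (hC : ∀ z ∈ Metric.ball (0 : ℂ) 1, ‖f z‖ ≤ C) :
    ∀ᵐ θ : ℝ, ∃ c : ℂ,
      Tendsto (fun r : ℝ => f (r * Complex.exp (θ * I))) (𝓝[<] 1) (𝓝 c) := by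
  -- A primitive of a bounded function is Lipschitz on the convex disc. Its Lipschitz extension
  -- supplies boundary values on the circle.
  obtain ⟨g₀, hg₀⟩ := hf.isExactOn_ball
  have hL₀ : LipschitzOnWith C.toNNReal g₀ (Metric.ball 0 1) := by
    refine (convex_ball (0 : ℂ) 1).lipschitzOnWith_of_nnnorm_deriv_le (𝕜 := ℂ)
      (fun z hz => (hg₀ z hz).differentiableAt) fun z hz => ?_
    rw [(hg₀ z hz).deriv, ← NNReal.coe_le_coe, coe_nnnorm]
    exact (hC z hz).trans (Real.le_coe_toNNReal C)
  obtain ⟨g, hg, hgg⟩ := hL₀.extend_finite_dimension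
  set L := lipschitzExtensionConstant ℂ * C.toNNReal
  have hgd : ∀ z ∈ Metric.ball (0 : ℂ) 1, HasDerivAt g (f z) z := fun z hz =>
    (hg₀ z hz).congr_of_eventuallyEq
      (Filter.eventuallyEq_of_mem (Metric.isOpen_ball.mem_nhds hz) hgg.symm)
  have hGL : ∃ K, LipschitzWith K fun θ : ℝ => g (circleMap 0 1 θ) :=
    ⟨_, hg.comp (lipschitzWith_circleMap 0 1)⟩
  obtain ⟨K, hK⟩ := hGL
  -- A Lipschitz function of a real variable is differentiable almost everywhere.
  filter_upwards [hK.ae_differentiableAt] with θ₀ hθ₀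
  set ζ₀ := circleMap 0 1 θ₀ with hζ₀
  have hn0 : ‖ζ₀‖ = 1 := by simp [hζ₀]
  have hne : ζ₀ ≠ 0 := norm_pos_iff.1 (by rw [hn0]; exact one_pos)
  set B := deriv (fun θ : ℝ => g (circleMap 0 1 θ)) θ₀
  -- The velocity of the circle at `ζ₀` is `iζ₀`, so `A` is the complex slope of `g` along the
  -- circle. It will be the radial limit of `f`, and `e` is the error of the first-order expansion.
  set A := B / (ζ₀ * I) with hA
  let e : ℂ → ℂ := fun ζ => g ζ - g ζ₀ - A * (ζ - ζ₀)
  have hed : ∀ z ∈ Metric.ball (0 : ℂ) 1, HasDerivAt e (f z - A) z := by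
    intro z hz
    have h1 := (((hasDerivAt_id z).sub_const ζ₀).const_mul A)
    have h2 := ((hgd z hz).sub_const (g ζ₀)).sub h1
    rw [mul_one] at h2
    exact h2
  have he : DiffContOnCl ℂ e (Metric.ball 0 1) :=
    ⟨fun z hz => (hed z hz).differentiableAt.differentiableWithinAt, by
      have := hg.continuous
      exact Continuous.continuousOn (by fun_prop)⟩
  have hM : ∀ ζ : ℂ, ‖ζ‖ = 1 → ‖e ζ‖ ≤ (L + ‖A‖) * ‖ζ - ζ₀‖ := by
    intro ζ _
    refine (norm_sub_le _ _).trans ?_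
    rw [norm_mul, add_mul]
    gcongr
    exact hg.norm_sub_le ζ ζ₀
  have hderiv : HasDerivAt (fun θ : ℝ => e (circleMap 0 1 θ)) 0 θ₀ := by
    have h1 := hθ₀.hasDerivAt.sub_const (g ζ₀)
    have h2 := ((hasDerivAt_circleMap 0 1 θ₀).sub_const ζ₀).const_mul A
    have h3 := h1.sub h2
    have : B - A * (circleMap 0 1 θ₀ * I) = 0 := by
      rw [hA, ← hζ₀, div_mul_cancel₀ _ (mul_ne_zero hne I_ne_zero), sub_self]
    rw [this] at h3
    exact h3
  -- Differentiability in the angle becomes an estimate in the chord, since an angle is at most `π /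
  -- 2` times its chord.
  have ho : ∀ ε > 0, ∃ δ > 0, ∀ ζ : ℂ, ‖ζ‖ = 1 → ‖ζ - ζ₀‖ < δ → ‖e ζ‖ ≤ ε * ‖ζ - ζ₀‖ := by
    intro ε hε
    have h1 := (hasDerivAt_iff_isLittleO.1 hderiv).def
      (show 0 < ε / (Real.pi / 2) from div_pos hε (by positivity))
    obtain ⟨η, hη, hηe⟩ := Metric.eventually_nhds_iff.1 h1
    refine ⟨η / (Real.pi / 2), by positivity, fun ζ hζ hlt => ?_⟩
    have hζne : ζ ≠ 0 := norm_pos_iff.1 (by rw [hζ]; exact one_pos)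
    let t : ℝ := (ζ / ζ₀).arg
    have ht : |t| ≤ Real.pi / 2 * ‖ζ - ζ₀‖ := by
      have := angle_le_mul_norm_sub hζ hn0
      rwa [angle_eq_abs_arg hζne hne] at this
    have hmap : circleMap 0 1 (θ₀ + t) = ζ := by
      have h2 : ‖ζ / ζ₀‖ * Complex.exp (t * I) = ζ / ζ₀ := norm_mul_exp_arg_mul_I _
      rw [norm_div, hζ, hn0, div_one, ofReal_one, one_mul] at h2
      have h3 : ζ₀ = Complex.exp (θ₀ * I) := by simp [hζ₀, circleMap]
      rw [circleMap, ofReal_add, add_mul, Complex.exp_add, h2, ← h3]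
      field_simp
      simp
    have h4 := @hηe (θ₀ + t) (by
      rw [Real.dist_eq, add_sub_cancel_left]
      refine ht.trans_lt ?_
      rwa [lt_div_iff₀' (by positivity)] at hlt)
    have h5 : e ζ₀ = 0 := by simp [e]
    rw [hmap, ← hζ₀, h5, smul_zero, sub_zero, sub_zero, add_sub_cancel_left, Real.norm_eq_abs] at h4
    refine h4.trans ?_
    rw [div_mul_eq_mul_div, div_le_iff₀ (by positivity)]
    calc ε * |t| ≤ ε * (Real.pi / 2 * ‖ζ - ζ₀‖) := by gcongr
      _ = _ := by ring
  refine ⟨A, ?_⟩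
  have hlim := (he.tendsto_deriv_radial_zero hn0 hM ho).add_const A
  rw [zero_add] at hlim
  refine hlim.congr' ?_
  filter_upwards [Ioo_mem_nhdsLT (zero_lt_one : (0 : ℝ) < 1)] with r ⟨hr0, hr1⟩
  have h3 : ζ₀ = Complex.exp (θ₀ * I) := by simp [hζ₀, circleMap]
  rw [← h3, (hed _ _).deriv, sub_add_cancel]
  rw [mem_ball_zero_iff, norm_mul, hn0, Complex.norm_real, Real.norm_of_nonneg hr0.le, mul_one]
  exact hr1

/-! ### Inner functions and isometric multiplication operators -/

theorem AnalyticOnDisc.continuous_circle {f : 𝔻 → ℂ} (hf : AnalyticOnDisc f) {r : ℝ}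
    (h0 : 0 ≤ r) (h1 : r < 1) : Continuous fun θ : ℝ => discExt f (r * Complex.exp (θ * I)) := by
  refine (DifferentiableOn.continuousOn hf).comp_continuous (by fun_prop) fun θ => ?_
  rw [mem_ball_zero_iff, norm_mul, Complex.norm_exp_ofReal_mul_I, mul_one, Complex.norm_real,
    Real.norm_of_nonneg h0]
  exact h1

theorem norm_discExt_le {f : 𝔻 → ℂ} {C : ℝ} (hC : ∀ z, ‖f z‖ ≤ C) (z : ℂ) :
    ‖discExt f z‖ ≤ C := by
  by_cases hz : ‖z‖ < 1
  · simpa [discExt, hz] using hC (UnitDisc.mk z hz)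
  · simpa [discExt, hz] using (norm_nonneg _).trans (hC 0)

/-- The square means of a bounded analytic function converge to the mean of the boundary values. -/
theorem AnalyticOnDisc.tendsto_circleMean_of_radial {f : 𝔻 → ℂ} (hf : AnalyticOnDisc f) {C : ℝ}
    (hC : ∀ z, ‖f z‖ ≤ C) {u : ℝ → ℝ}
    (hu : ∀ᵐ θ : ℝ, Tendsto (fun r : ℝ => ‖discExt f (r * Complex.exp (θ * I))‖ ^ 2) (𝓝[<] 1)
      (𝓝 (u θ))) :
    Tendsto (circleMean f) (𝓝[<] 1) (𝓝 ((2 * Real.pi)⁻¹ * ∫ θ in 0..2 * Real.pi, u θ)) := by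
  have hcm : circleMean f = fun r : ℝ => (2 * Real.pi)⁻¹ *
      ∫ θ in 0..2 * Real.pi, ‖discExt f (r * Complex.exp (θ * I))‖ ^ 2 := by
    ext r
    simp [circleMean, Real.circleAverage_def, circleMap]
  rw [hcm]
  refine Tendsto.const_mul _ ?_
  refine intervalIntegral.tendsto_integral_filter_of_dominated_convergence (fun _ => C ^ 2)
    ?_ ?_ intervalIntegrable_const (hu.mono fun θ h _ => h)
  · filter_upwards [Ioo_mem_nhdsLT (zero_lt_one : (0 : ℝ) < 1)] with r hr
    exact ((hf.continuous_circle hr.1.le hr.2).norm.pow 2).aestronglyMeasurable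
  · refine Eventually.of_forall fun r => Eventually.of_forall fun θ _ => ?_
    rw [Real.norm_of_nonneg (by positivity)]
    gcongr
    exact norm_discExt_le hC _

/-- The failures of `P` lie in countably many translates of the exceptional set in one period. -/
theorem ae_of_ae_of_add_two_pi {P : ℝ → Prop}
    (hP : ∀ θ : ℝ, ∀ k : ℤ, P (θ + k • (2 * Real.pi)) → P θ)
    (h : ∀ᵐ θ : ℝ, θ ∈ Set.Ioc 0 (2 * Real.pi) → P θ) : ∀ᵐ θ : ℝ, P θ := by
  have h' : ∀ᵐ θ : ℝ, ∀ k : ℤ, θ + k • (2 * Real.pi) ∈ Set.Ioc 0 (2 * Real.pi) →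
      P (θ + k • (2 * Real.pi)) := by
    rw [MeasureTheory.ae_all_iff]
    intro k
    exact (MeasureTheory.measurePreserving_add_right MeasureTheory.volume
      (k • (2 * Real.pi))).quasiMeasurePreserving.ae h
  filter_upwards [h'] with θ hθ
  obtain ⟨k, hk, -⟩ := existsUnique_add_zsmul_mem_Ioc Real.two_pi_pos θ 0
  rw [zero_add] at hk
  exact hP θ k (hθ k hk)

/-- The boundary values exist by Fatou's theorem and have modulus at most `1`. Their mean square is
`‖f‖² = 1`, so `1 - |c|²` is nonnegative with zero integral and vanishes almost everywhere. -/
theorem isInnerFunction_of_norm_eq_one {J : HInfty} (hJ : ∀ z, ‖J.1 z‖ ≤ 1) {f : HardyTwo}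
    (hf : f.toFun = J.1) (hf1 : ‖f‖ = 1) : IsInnerFunction J := by
  have hA : AnalyticOnDisc J.1 := J.2.1
  have hlim := ae_exists_radial_limit hA fun z _ => norm_discExt_le hJ z
  -- Where the radial limit does not exist, the value is arbitrary; this happens only on a null set.
  let c : ℝ → ℂ := fun θ => limUnder (𝓝[<] (1 : ℝ))
    fun r : ℝ => discExt J.1 (r * Complex.exp (θ * I))
  have hc : ∀ᵐ θ : ℝ, Tendsto (fun r : ℝ => discExt J.1 (r * Complex.exp (θ * I))) (𝓝[<] 1)
      (𝓝 (c θ)) := hlim.mono fun θ h => tendsto_nhds_limUnder h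
  have hc1 : ∀ᵐ θ : ℝ, ‖c θ‖ ≤ 1 := hc.mono fun θ h =>
    le_of_tendsto h.norm (Eventually.of_forall fun r => norm_discExt_le hJ _)
  have hmeas : AEMeasurable (fun θ => ‖c θ‖ ^ 2) := by
    -- Measurability passes to limits of sequences, so the radius runs through a sequence increasing
    -- to `1`.
    obtain ⟨s, -, hs, hs1⟩ := exists_seq_strictMono_tendsto' (zero_lt_one : (0 : ℝ) < 1)
    have hs' : Tendsto s atTop (𝓝[<] 1) :=
      tendsto_nhdsWithin_iff.2 ⟨hs1, Eventually.of_forall fun n => (hs n).2⟩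
    refine aemeasurable_of_tendsto_metrizable_ae' (f := fun (n : ℕ) (θ : ℝ) =>
      ‖discExt J.1 (s n * Complex.exp (θ * I))‖ ^ 2) (fun n => ?_)
      (hc.mono fun θ h => (h.comp hs').norm.pow 2)
    exact ((hA.continuous_circle (hs n).1.le (hs n).2).norm.pow 2).aemeasurable
  have hint : IntervalIntegrable (fun θ => ‖c θ‖ ^ 2) MeasureTheory.volume 0 (2 * Real.pi) := by
    refine (intervalIntegrable_const (c := (1 : ℝ))).mono_fun hmeas.aestronglyMeasurable.restrict ?_
    refine MeasureTheory.ae_restrict_of_ae (hc1.mono fun θ h => ?_)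
    simpa using (sq_le_one_iff₀ (norm_nonneg _)).2 h
  have h1 := hA.tendsto_circleMean_of_radial hJ (hc.mono fun θ h => h.norm.pow 2)
  have h2 := f.tendsto_circleMean
  rw [hf, hf1] at h2
  have h3 := tendsto_nhds_unique h1 h2
  have h4 : ∫ θ in 0..2 * Real.pi, (1 - ‖c θ‖ ^ 2) = 0 := by
    rw [intervalIntegral.integral_sub intervalIntegrable_const hint]
    have hpi := Real.pi_pos
    field_simp at h3
    simp
    linarith
  rw [intervalIntegral.integral_eq_zero_iff_of_le_of_nonneg_ae Real.two_pi_pos.le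
    (MeasureTheory.ae_restrict_of_ae (hc1.mono fun θ h => by
      have := pow_le_one₀ (n := 2) (norm_nonneg _) h
      simpa using this)) (intervalIntegrable_const.sub hint)] at h4
  rw [Filter.EventuallyEq, MeasureTheory.ae_restrict_iff' measurableSet_Ioc] at h4
  refine ae_of_ae_of_add_two_pi (fun θ k h => ?_) ?_
  · have : Complex.exp (((θ + k • (2 * Real.pi) : ℝ) : ℂ) * I) = Complex.exp (θ * I) := by
      rw [Complex.exp_eq_exp_iff_exists_int]
      exact ⟨k, by push_cast; simp; ring⟩
    rwa [this] at h
  · filter_upwards [h4, hc] with θ h5 h6 h7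
    refine ⟨c θ, ?_, h6⟩
    have := h5 h7
    simp only [Pi.zero_apply] at this
    exact (pow_eq_one_iff_of_nonneg (norm_nonneg _) two_ne_zero).1 (by linarith)

/-- If `J` is inner and `p` is continuous up to the boundary, then `‖J p‖ = ‖p‖`. -/
theorem IsInnerFunction.norm_smul_eq {J : HInfty} (hJ : IsInnerFunction J) {p : HardyTwo}
    {F : ℂ → ℂ} (hF : Continuous F) (hp : ∀ z : 𝔻, p.toFun z = F z) : ‖J • p‖ = ‖p‖ := by
  obtain ⟨C, hC⟩ := hInfty_exists_bound J
  have hC0 : 0 ≤ C := (norm_nonneg _).trans (hC 0)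
  obtain ⟨D, hD⟩ := (isCompact_closedBall (0 : ℂ) 1).exists_bound_of_continuousOn hF.continuousOn
  have hpD : ∀ z, ‖p.toFun z‖ ≤ D := fun z => by
    rw [hp]; exact hD _ (mem_closedBall_zero_iff.2 z.norm_lt_one.le)
  have hD0 : 0 ≤ D := (norm_nonneg _).trans (hpD 0)
  have hFlim : ∀ θ : ℝ, Tendsto (fun r : ℝ => discExt p.toFun (r * Complex.exp (θ * I))) (𝓝[<] 1)
      (𝓝 (F (Complex.exp (θ * I)))) := by
    intro θ
    have h1 : Continuous fun r : ℝ => F (r * Complex.exp (θ * I)) := by fun_prop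
    have h2 := (h1.tendsto 1).mono_left (nhdsWithin_le_nhds (s := Set.Iio 1))
    simp only [ofReal_one, one_mul] at h2
    refine h2.congr' ?_
    filter_upwards [Ioo_mem_nhdsLT (zero_lt_one : (0 : ℝ) < 1)] with r hr
    have hz : ‖(r : ℂ) * Complex.exp (θ * I)‖ < 1 := by
      rw [norm_mul, Complex.norm_exp_ofReal_mul_I, mul_one, Complex.norm_real,
        Real.norm_of_nonneg hr.1.le]
      exact hr.2
    simp only [discExt, hz, dif_pos, hp]
    rfl
  have h1 := p.analytic.tendsto_circleMean_of_radial hpD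
    (Eventually.of_forall fun θ => (hFlim θ).norm.pow 2)
  have h2 := (J • p).analytic.tendsto_circleMean_of_radial (C := C * D)
    (u := fun θ => ‖F (Complex.exp (θ * I))‖ ^ 2)
    (fun z => by
      rw [HardyTwo.toFun_hsmul, Pi.mul_apply, norm_mul]
      exact mul_le_mul (hC z) (hpD z) (norm_nonneg _) hC0)
    (hJ.mono fun θ ⟨c, hc1, hc⟩ => by
      have := ((hc.mul (hFlim θ)).norm.pow 2)
      rw [norm_mul, hc1, one_mul] at this
      rw [HardyTwo.toFun_hsmul, discExt_mul]
      exact this)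
  have h3 := (tendsto_nhds_unique (J • p).tendsto_circleMean h2).trans
    (tendsto_nhds_unique p.tendsto_circleMean h1).symm
  exact (sq_eq_sq₀ (norm_nonneg _) (norm_nonneg _)).1 h3

/-! ### Wandering vectors of the shift -/

namespace HardyTwo

theorem shift_iterate_toFun (f : HardyTwo) (n : ℕ) (z : 𝔻) :
    ((shift^[n]) f).toFun z = (z : ℂ) ^ n * f.toFun z := by
  induction n with
  | zero => simp
  | succ n ih =>
    rw [Function.iterate_succ_apply']
    change (z : ℂ) * _ = _
    rw [ih, pow_succ]; ring

theorem inner_shift_iterate (f g : HardyTwo) (n m : ℕ) :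
    inner ℂ (shift^[n] f) (shift^[n + m] g) = inner ℂ f (shift^[m] g) := by
  induction n with
  | zero => simp
  | succ n ih =>
    rw [Function.iterate_succ_apply', show n + 1 + m = (n + m) + 1 by ring,
      Function.iterate_succ_apply', shift.inner_map_map, ih]

/-- A unit vector orthogonal to its forward shifts is an isometric multiplier. -/
theorem exists_isometric_mul {φ : HardyTwo} (h1 : ‖φ‖ = 1)
    (h : ∀ n : ℕ, inner ℂ φ (shift^[n + 1] φ) = 0) :
    ∃ T : HardyTwo →ₗᵢ[ℂ] HardyTwo, (∀ f, (T f).toFun = φ.toFun * f.toFun) ∧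
      ∀ f, HasSum (fun n => taylorCoeff f.toFun n • shift^[n] φ) (T f) := by
  have hnorm : ∀ n, ‖shift^[n] φ‖ = 1 := by
    intro n
    induction n with
    | zero => exact h1
    | succ n ih => rw [Function.iterate_succ_apply', shift.norm_map, ih]
  have hlt : ∀ n m, n < m → inner ℂ (shift^[n] φ) (shift^[m] φ) = 0 := by
    intro n m hnm
    obtain ⟨k, rfl⟩ := Nat.exists_eq_add_of_lt hnm
    rw [add_assoc, inner_shift_iterate, h]
  have ho : Orthonormal ℂ fun n => shift^[n] φ := by
    refine ⟨hnorm, fun n m hnm => ?_⟩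
    rcases lt_or_gt_of_ne hnm with hlt' | hgt
    · exact hlt n m hlt'
    · exact inner_eq_zero_symm.1 (hlt m n hgt)
  have hO := ho.orthogonalFamily
  let toSeqI : HardyTwo →ₗᵢ[ℂ] lp (fun _ : ℕ => ℂ) 2 := ⟨toSeq, fun f => rfl⟩
  -- `T` sends `zⁿ` to the orthonormal vector `zⁿφ`. Evaluation at a point is continuous, so the
  -- series for `T f` sums pointwise to `φ f`.
  let T : HardyTwo →ₗᵢ[ℂ] HardyTwo := hO.linearIsometry.comp toSeqI
  have hsum : ∀ f, HasSum (fun n => taylorCoeff f.toFun n • shift^[n] φ) (T f) := fun f =>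
    hO.hasSum_linearIsometry (toSeq f)
  refine ⟨T, fun f => ?_, hsum⟩
  ext z
  have e1 := (evalL z).hasSum (hsum f)
  have hz : (z : ℂ) ∈ Metric.ball (0 : ℂ) 1 := mem_ball_zero_iff.2 z.norm_lt_one
  have e2 := (f.analytic.hasSum hz).mul_left (φ.toFun z)
  rw [discExt_coe] at e2
  refine e1.unique ?_
  convert! e2 using 2 with n
  simp only [map_smul, evalL_apply, shift_iterate_toFun, smul_eq_mul]
  ring

/-- The powers `φⁿ = Tⁿ 1` are unit vectors, so `|φ(z)|ⁿ` is bounded by `(1 - |z|)⁻¹` for every `n`.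
-/
theorem norm_toFun_le_one_of_isometric_mul {φ : HardyTwo} (T : HardyTwo →ₗᵢ[ℂ] HardyTwo)
    (hT : ∀ f, (T f).toFun = φ.toFun * f.toFun) (z : 𝔻) : ‖φ.toFun z‖ ≤ 1 := by
  have hpow : ∀ n : ℕ, ‖T^[n] one‖ = 1 ∧ (T^[n] one).toFun z = φ.toFun z ^ n := by
    intro n
    induction n with
    | zero => exact ⟨norm_one, by simp [one_toFun]⟩
    | succ n ih =>
      rw [Function.iterate_succ_apply', T.norm_map, hT, Pi.mul_apply, ih.2, pow_succ']
      exact ⟨ih.1, rfl⟩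
  by_contra! hlt
  obtain ⟨n, hn⟩ := pow_unbounded_of_one_lt (1 - ‖(z : ℂ)‖)⁻¹ hlt
  have := norm_apply_le (T^[n] one) z
  rw [(hpow n).1, (hpow n).2, norm_pow, mul_one] at this
  linarith

end HardyTwo

/-! ### Shift invariant subspaces -/

namespace HardyTwo

/-- Elements of `U` can be divided by `z` inside `U` any number of times, so their order at `0` is
infinite. -/
theorem eq_zero_of_forall_eq_shift {U : Set HardyTwo} (hU : ∀ g ∈ U, ∃ v ∈ U, g = shift v)
    {g : HardyTwo} (hg : g ∈ U) : g = 0 := by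
  refine eq_zero_of_forall_le_ord fun n => ?_
  induction n generalizing g with
  | zero => simp
  | succ n ih =>
    obtain ⟨v, hv, rfl⟩ := hU g hg
    exact succ_le_ord_shift (ih hv)

/-- An element of `V` orthogonal to the wandering subspace `V ⊖ zV` lies in `zV`. -/
theorem exists_eq_shift_of_orthogonal_wandering {V : Submodule ℂ HardyTwo}
    (hV : IsClosed (V : Set HardyTwo)) (hS : ∀ v ∈ V, shift v ∈ V) {g : HardyTwo} (hg : g ∈ V)
    (h : ∀ w ∈ V, (∀ v ∈ V, inner ℂ w (shift v) = 0) → inner ℂ w g = 0) :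
    ∃ v ∈ V, g = shift v := by
  let K : Submodule ℂ HardyTwo := V.map shift.toLinearMap
  have : CompleteSpace K :=
    ((LinearIsometry.isComplete_map_iff shift).2 hV.isComplete).completeSpace_coe
  have hKV : K ≤ V := by
    rintro _ ⟨v, hv, rfl⟩
    exact hS v hv
  have hp := K.starProjection_apply_mem g
  have horth := K.sub_starProjection_mem_orthogonal g
  have h1 := h (g - K.starProjection g) (V.sub_mem hg (hKV hp)) fun v hv =>
    inner_eq_zero_symm.1 (horth _ ⟨v, hv, rfl⟩)
  have h2 : inner ℂ (g - K.starProjection g) (K.starProjection g) = 0 :=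
    inner_eq_zero_symm.1 (horth _ hp)
  have h3 : inner ℂ (g - K.starProjection g) (g - K.starProjection g) = 0 := by
    rw [inner_sub_right (g - _), h1, h2, sub_zero]
  rw [inner_self_eq_zero, sub_eq_zero] at h3
  obtain ⟨v, hv, hvg⟩ := hp
  exact ⟨v, hv, h3.trans hvg.symm⟩

/-- If `V ⊖ zV` were zero, then `V = zV`, and every element of `V` would be infinitely divisible by
`z`. -/
theorem exists_wandering {V : Submodule ℂ HardyTwo} (hV : IsClosed (V : Set HardyTwo))
    (hne : V ≠ ⊥) (hS : ∀ v ∈ V, shift v ∈ V) :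
    ∃ φ ∈ V, ‖φ‖ = 1 ∧ ∀ v ∈ V, inner ℂ φ (shift v) = 0 := by
  by_contra! hcon
  have hzero : ∀ w ∈ V, (∀ v ∈ V, inner ℂ w (shift v) = 0) → w = 0 := by
    intro w hw hwv
    by_contra hw0
    obtain ⟨v, hv, hvne⟩ := hcon (((‖w‖⁻¹ : ℝ) : ℂ) • w) (V.smul_mem _ hw) (by
      rw [norm_smul]
      simp [norm_ne_zero_iff.2 hw0])
    rw [inner_smul_left, hwv v hv, mul_zero] at hvne
    exact hvne rfl
  refine hne ((Submodule.eq_bot_iff V).2 fun g hg =>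
    eq_zero_of_forall_eq_shift (U := V) (fun g hg => ?_) hg)
  exact exists_eq_shift_of_orthogonal_wandering hV hS hg fun w hw hwv => by
    rw [hzero w hw hwv, inner_zero_left]

/-- The wandering subspace `V ⊖ zV` has dimension at most one. -/
theorem wandering_unique {φ g : HardyTwo} (hφ : ‖φ‖ = 1)
    (hφφ : ∀ n : ℕ, inner ℂ φ (shift^[n + 1] φ) = 0)
    (hgg : ∀ n : ℕ, inner ℂ g (shift^[n + 1] g) = 0)
    (hφg : ∀ n : ℕ, inner ℂ φ (shift^[n] g) = 0)
    (hgφ : ∀ n : ℕ, inner ℂ g (shift^[n] φ) = 0) : g = 0 := by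
  by_contra hg
  have hgn : ‖g‖ ≠ 0 := norm_ne_zero_iff.2 hg
  have hit : ∀ (n : ℕ) (c : ℂ) (f : HardyTwo), shift^[n] (c • f) = c • shift^[n] f := by
    intro n c f
    induction n with
    | zero => rfl
    | succ n ih => rw [Function.iterate_succ_apply', ih, map_smul, Function.iterate_succ_apply']
  let c : ℂ := ((‖g‖⁻¹ : ℝ) : ℂ)
  obtain ⟨T, hT, hTs⟩ := exists_isometric_mul hφ hφφ
  obtain ⟨U, hU, hUs⟩ := exists_isometric_mul (φ := c • g)
    (by rw [norm_smul]; simp [c, hgn])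
    (fun n => by rw [hit, inner_smul_left, inner_smul_right, hgg]; simp)
  have horth : ∀ n m : ℕ, inner ℂ (shift^[n] φ) (shift^[m] (c • g)) = 0 := by
    intro n m
    rw [hit, inner_smul_right]
    rcases le_total n m with h | h
    · obtain ⟨k, rfl⟩ := Nat.exists_eq_add_of_le h
      rw [inner_shift_iterate, hφg, mul_zero]
    · obtain ⟨k, rfl⟩ := Nat.exists_eq_add_of_le h
      rw [inner_eq_zero_symm.1 ((inner_shift_iterate g φ m k).trans (hgφ k)), mul_zero]
  -- Commutativity of multiplication puts the product of `φ` and `c • g` in the ranges of both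
  -- isometries. These ranges are orthogonal, yet the product has norm `1`.
  have hTU : T (c • g) = U φ := toFun_injective (by rw [hT, hU, mul_comm])
  have h1 : ∀ n : ℕ, inner ℂ (shift^[n] φ) (U φ) = 0 := by
    intro n
    have := (innerSL ℂ (shift^[n] φ)).hasSum (hUs φ)
    refine this.unique ?_
    convert! hasSum_zero using 2 with m
    simp [horth]
  have h2 : inner ℂ (U φ) (T (c • g)) = 0 := by
    have := (innerSL ℂ (U φ)).hasSum (hTs (c • g))
    refine this.unique ?_
    convert! hasSum_zero using 2 with m
    simp [inner_eq_zero_symm.1 (h1 m)]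
  rw [hTU, inner_self_eq_zero] at h2
  have := U.norm_map φ
  rw [h2, hφ, norm_zero] at this
  exact zero_ne_one this

theorem shift_iterate_mem {V : Submodule ℂ HardyTwo} (hS : ∀ v ∈ V, shift v ∈ V) {v : HardyTwo}
    (hv : v ∈ V) (n : ℕ) : shift^[n] v ∈ V := by
  induction n with
  | zero => exact hv
  | succ n ih => rw [Function.iterate_succ_apply']; exact hS _ ih

end HardyTwo

open HardyTwo

/-- **Beurling's theorem**: a nonzero closed shift invariant subspace is generated by an inner
function. -/
theorem exists_inner_of_shift_invariant {V : Submodule ℂ HardyTwo}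
    (hV : IsClosed (V : Set HardyTwo)) (hne : V ≠ ⊥) (hS : ∀ v ∈ V, shift v ∈ V) :
    ∃ J : HInfty, IsInnerFunction J ∧ V = mulHardy J := by
  obtain ⟨φ, hφV, hφ1, hφ⟩ := exists_wandering hV hne hS
  have hφn : ∀ {v : HardyTwo} (n : ℕ), v ∈ V → inner ℂ φ (shift^[n + 1] v) = 0 := fun n hv => by
    rw [Function.iterate_succ_apply']
    exact hφ _ (shift_iterate_mem hS hv n)
  obtain ⟨T, hT, hTs⟩ := exists_isometric_mul hφ1 fun n => hφn n hφV
  have hle := norm_toFun_le_one_of_isometric_mul T hT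
  let J : HInfty := ⟨φ.toFun, φ.analytic, 1, hle⟩
  have hJT : ∀ f, J • f = T f := fun f => toFun_injective (hT f).symm
  have hJV : ∀ f, T f ∈ V := fun f =>
    hV.mem_of_tendsto (hTs f) (Eventually.of_forall fun s =>
      V.sum_mem fun n _ => V.smul_mem _ (shift_iterate_mem hS hφV n))
  have hJ1 : T one = φ := toFun_injective (by rw [hT]; exact mul_one φ.toFun)
  refine ⟨J, isInnerFunction_of_norm_eq_one hle rfl hφ1, le_antisymm ?_ ?_⟩
  swap
  · rintro _ ⟨f, rfl⟩
    rw [hJT]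
    exact hJV f
  -- The component of `w` orthogonal to `φ` is again wandering, so it vanishes by
  -- `wandering_unique`.
  have hwander : ∀ w ∈ V, (∀ v ∈ V, inner ℂ w (shift v) = 0) → w = (inner ℂ φ w : ℂ) • φ := by
    intro w hw hwv
    let g := w - (inner ℂ φ w : ℂ) • φ
    have hg : g ∈ V := V.sub_mem hw (V.smul_mem _ hφV)
    have hgv : ∀ {v : HardyTwo} (n : ℕ), v ∈ V → inner ℂ g (shift^[n + 1] v) = 0 := by
      intro v n hv
      rw [inner_sub_left, inner_smul_left, hφn n hv, Function.iterate_succ_apply',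
        hwv _ (shift_iterate_mem hS hv n), mul_zero, sub_zero]
    have hφg : inner ℂ φ g = 0 := by
      rw [inner_sub_right, inner_smul_right, inner_self_eq_norm_sq_to_K, hφ1]
      simp
    refine sub_eq_zero.1 (wandering_unique hφ1 (fun n => hφn n hφV) (fun n => hgv n hg) ?_ ?_)
    · rintro (_ | n)
      · exact hφg
      · exact hφn n hg
    · rintro (_ | n)
      · exact inner_eq_zero_symm.1 hφg
      · exact hgv n hφV
  -- `U` is `V ⊖ φH²`. Its elements are orthogonal to the wandering line, hence of the form `zv`
  -- with `v ∈ V`; since `φH²` is stable under `z` and the shift is isometric, `v` lies in `U`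
  -- again.
  let U : Set HardyTwo := {g | g ∈ V ∧ ∀ f, inner ℂ (T f) g = 0}
  have hU : ∀ g ∈ U, ∃ v ∈ U, g = shift v := by
    rintro g ⟨hgV, hgT⟩
    obtain ⟨v, hv, rfl⟩ := exists_eq_shift_of_orthogonal_wandering hV hS hgV fun w hw hwv => by
      have := hgT one
      rw [hJ1] at this
      rw [hwander w hw hwv, inner_smul_left, this, mul_zero]
    refine ⟨v, ⟨hv, fun f => ?_⟩, rfl⟩
    have := hgT (shift f)
    rwa [← hJT, ← shift_hsmul, shift.inner_map_map, hJT] at this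
  intro x hx
  let K : Submodule ℂ HardyTwo := LinearMap.range T.toLinearMap
  have hK : IsClosed (K : Set HardyTwo) := by
    have := T.isometry.isClosedEmbedding.isClosed_range
    exact this
  have := hK.completeSpace_coe
  have hp := K.starProjection_apply_mem x
  have horth := K.sub_starProjection_mem_orthogonal x
  have hKV : K ≤ V := by
    rintro _ ⟨f, rfl⟩
    exact hJV f
  have h0 := eq_zero_of_forall_eq_shift hU
    (show x - K.starProjection x ∈ U from ⟨V.sub_mem hx (hKV hp), fun f => horth _ ⟨f, rfl⟩⟩)
  obtain ⟨f, hf⟩ := hp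
  exact ⟨f, by rw [hJT, sub_eq_zero.1 h0]; exact hf.symm⟩

/-! ### Subspaces generated by an inner function -/

theorem shift_iterate_hsmul (r : HInfty) (f : HardyTwo) (n : ℕ) :
    shift^[n] (r • f) = r • shift^[n] f := by
  induction n with
  | zero => rfl
  | succ n ih => rw [Function.iterate_succ_apply', ih, shift_hsmul, Function.iterate_succ_apply']

/-- Multiplication by an inner function is isometric. -/
theorem IsInnerFunction.exists_linearIsometry {J : HInfty} (hJ : IsInnerFunction J) :
    ∃ T : HardyTwo →ₗᵢ[ℂ] HardyTwo, ∀ f, T f = J • f := by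
  have hone : ‖J • one‖ = 1 := by
    rw [hJ.norm_smul_eq (F := fun _ => 1) continuous_const one_toFun, HardyTwo.norm_one]
  have horth : ∀ n : ℕ, inner ℂ (J • one) (shift^[n + 1] (J • one)) = 0 := by
    intro n
    rw [shift_iterate_hsmul]
    set q := shift^[n + 1] one with hq
    have hq1 : inner ℂ one q = 0 := by
      rw [hq, Function.iterate_succ_apply', inner_one_shift]
    have hnq : ‖J • q‖ = ‖q‖ := hJ.norm_smul_eq (F := fun z => z ^ (n + 1)) (by fun_prop) fun z => by
      rw [hq, shift_iterate_toFun, one_toFun, mul_one]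
    -- Polarization: `J` preserves the norms of `1`, `q` and `1 + c q`, and `1` is orthogonal to
    -- `q`, so the cross term vanishes. The values `c = 1` and `c = i` give its real and imaginary
    -- parts. Only polynomials are tested, so boundary values of general `H²` functions are not
    -- needed.
    have key : ∀ c : ℂ, (c * inner ℂ (J • one) (J • q)).re = 0 := by
      intro c
      have h1 : ‖J • (one + c • q)‖ = ‖one + c • q‖ :=
        hJ.norm_smul_eq (F := fun z => 1 + c * z ^ (n + 1)) (by fun_prop) fun z => by
          rw [toFun_add, toFun_smul, Pi.add_apply, Pi.smul_apply, hq, shift_iterate_toFun,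
            one_toFun, mul_one, smul_eq_mul]
      have h2 : J • (one + c • q) = J • one + c • (J • q) := by
        rw [← mulL_apply, map_add, map_smul]; rfl
      rw [h2, ← sq_eq_sq₀ (norm_nonneg _) (norm_nonneg _), @norm_add_sq ℂ, @norm_add_sq ℂ, hone,
        HardyTwo.norm_one, _root_.norm_smul c (J • q),
        _root_.norm_smul c q, hnq, inner_smul_right,
        inner_smul_right, hq1] at h1
      simpa using h1
    have h1 := key 1
    have h2 := key I
    apply Complex.ext
    · simpa using h1
    · simpa using h2
  obtain ⟨T, hT, -⟩ := exists_isometric_mul hone horth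
  refine ⟨T, fun f => toFun_injective ?_⟩
  rw [hT, toFun_hsmul, toFun_hsmul]
  congr 1
  exact mul_one J.1

theorem IsInnerFunction.isClosed_mulHardy {J : HInfty} (hJ : IsInnerFunction J) :
    IsClosed (mulHardy J : Set HardyTwo) := by
  obtain ⟨T, hT⟩ := hJ.exists_linearIsometry
  have : (mulHardy J : Set HardyTwo) = Set.range T := by
    ext x
    exact ⟨fun ⟨f, hf⟩ => ⟨f, (hT f).trans hf.symm⟩, fun ⟨f, hf⟩ => ⟨f, hf.symm.trans (hT f)⟩⟩
  rw [this]
  exact T.isometry.isClosedEmbedding.isClosed_range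

theorem IsInnerFunction.mulHardy_ne_bot {J : HInfty} (hJ : IsInnerFunction J) :
    mulHardy J ≠ ⊥ := by
  obtain ⟨T, hT⟩ := hJ.exists_linearIsometry
  intro h
  have h0 : T one = 0 := (Submodule.eq_bot_iff _).1 h _ ⟨one, hT one⟩
  have := T.norm_map one
  rw [h0, HardyTwo.norm_one, norm_zero] at this
  exact zero_ne_one this

theorem isInvariantUnder_mulHardy (R : Subalgebra ℂ HInfty) (J : HInfty) :
    IsInvariantUnder R (mulHardy J) := by
  rintro r - _ ⟨f, rfl⟩
  exact ⟨r • f, hsmul_comm r J f⟩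

end

/-! ### The theorem -/

theorem theorem8p1 (R : Subalgebra ℂ HInfty) (hR : R = polyAlgebra ∨ R = ⊤) :
    (∀ V : Submodule ℂ HardyTwo, IsClosed (V : Set HardyTwo) → V ≠ ⊥ →
      IsNearInner R V → HasFullProjection R V →
        IsInvariantUnder R V ∧ ∃ I : HInfty, IsInnerFunction I ∧ V = mulHardy I) ∧
    (∀ I : HInfty, IsInnerFunction I →
      IsClosed (mulHardy I : Set HardyTwo) ∧ mulHardy I ≠ ⊥ ∧
        IsInvariantUnder R (mulHardy I)) ∧
    (∀ V : Submodule ℂ HardyTwo, IsClosed (V : Set HardyTwo) → V ≠ ⊥ →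
      (IsInvariantUnder R V ↔ ∃ I : HInfty, IsInnerFunction I ∧ V = mulHardy I)) := by
  -- Both algebras contain `z`, so `R`-invariance implies shift invariance, which is what Beurling's
  -- theorem needs.
  have hz : coordZ ∈ R := by
    rcases hR with rfl | rfl
    · exact Algebra.self_mem_adjoin_singleton ℂ coordZ
    · exact Algebra.mem_top
  have beurling : ∀ V : Submodule ℂ HardyTwo, IsClosed (V : Set HardyTwo) → V ≠ ⊥ →
      IsInvariantUnder R V → ∃ I : HInfty, IsInnerFunction I ∧ V = mulHardy I :=
    fun V hV hne hinv => exists_inner_of_shift_invariant hV hne fun v hv => hinv coordZ hz v hv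
  refine ⟨fun V hV hne hN hF => ?_, fun J hJ => ?_, fun V hV hne => ⟨beurling V hV hne, ?_⟩⟩
  · have hinv := isInvariantUnder_of_nearInner hV hN hF
    exact ⟨hinv, beurling V hV hne hinv⟩
  · exact ⟨hJ.isClosed_mulHardy, hJ.mulHardy_ne_bot, isInvariantUnder_mulHardy R J⟩
  · rintro ⟨J, -, rfl⟩
    exact isInvariantUnder_mulHardy R J
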